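/- Let $q$ be a power of an odd prime and let $P\in\mathbb F_q[X]$ be a fixed irreducible polynomial. Throughout, $d,g$ are non-negative integers and $Q$ runs over the monic irreducible polynomials of $\mathbb F_q[X]$. Let $\chi_P^+(F)=\chi_P(F)=\left(\frac FP\right)$ be the quadratic residue symbol ($0$ if $P\mid F$, $1$ if $F$ is a non-zero square modulo $P$, $-1$ otherwise) and let $\chi_P^-(F)=(-1)^{\deg F}\chi_P(F)$. Let $\mu^2$ be the indicator function of the square-free polynomials, and let $\eta_g=1$ if $g$ is even and $\eta_g=0$ if $g$ is odd. Put $$Z(u)=\sum_{F\text{ monic}}u^{\deg F}\ \ (|u|<q^{-1}),\qquad \zeta_q(s)=Z(q^{-s}),\qquad L(u,\chi_P^{\pm})=\sum_{d\ge 0}\Big(\sum_{F\text{ monic},\,\deg F=d}\chi_P^{\pm}(F)\Big)u^d,$$ $$H_{P,\pm}(u)=\prod_Q\left(1+u^{\deg Q}+2\chi_P^{\pm}(Q)u^{\deg Q}\right)\left(1-u^{\deg Q}\right)\left(1-\chi_P^{\pm}(Q)u^{\deg Q}\right)^2,$$ $$H_{P,0}(u)=\prod_Q\left(1+\big((-1)^{\deg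 Q}+\chi_P^+(Q)+\chi_P^-(Q)\big)u^{\deg Q}\right)\left(1-(-u)^{\deg Q}\right)\left(1-\chi_P^+(Q)u^{\deg Q}\right)\left(1-\chi_P^-(Q)u^{\deg Q}\right).$$ For non-negative integers $d_1,d_2,d_3$ let $L(d_1,d_2,d_3)=d_1+d_2+d_3$ if $d_1+d_3$ and $d_2+d_3$ are both even, and $L(d_1,d_2,d_3)=d_1+d_2+d_3+1$ otherwise. Let $\mathcal F_g$ be the set of triples $(f_1,f_2,f_3)$ of monic, square-free, pairwise coprime polynomials in $\mathbb F_q[X]$ such that $L(\deg f_1,\deg f_2,\deg f_3)=g+3$ and the multiset $\{\deg f_1,\deg f_2,\deg f_3\}$ is neither $\{g+3,0,0\}$ nor $\{g+2,0,0\}$. For $k_1,k_2\in\{0,1\}$ let $$N_{k_1,k_2}(d;P)=\sum_{\substack{f_1,f_2,f_3\text{ monic},\ \deg(f_1f_2f_3)=d\\ \deg(f_1f_3)\equiv k_1,\ \deg(f_2f_3)\equiv k_2\ (\mathrm{mod}\ 2)}}\mu^2(f_1f_2f_3)\,\chi_P(f_1f_2).$$ Then the following hold. 1. The coefficient of $u^d$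 in $L(u,\chi_P^{\pm})$ vanishes for all $d\ge\deg P$, so that $L(u,\chi_P^\pm)$ is a polynomial in $u$; and the products $H_{P,+}(u)$, $H_{P,-}(u)$, $H_{P,0}(u)$ converge for all complex $u$ with $|u|<q^{-1/2}$. 2. For all $k_1,k_2\in\{0,1\}$ and every $\epsilon>0$, $$N_{k_1,k_2}(d;P)=\frac{C_{k_1,k_2}(d;P)}4\,q^d+O\!\left(q^{(\frac12+\epsilon)d}\right)\qquad(d\ge 0),$$ where $$C_{k_1,k_2}(d;P)=L(q^{-1},\chi_P^+)^2H_{P,+}(q^{-1})+(-1)^{k_1+k_2}L(q^{-1},\chi_P^-)^2H_{P,-}(q^{-1})+(-1)^d\big((-1)^{k_1}+(-1)^{k_2}\big)L(q^{-1},\chi_P^+)L(q^{-1},\chi_P^-)H_{P,0}(q^{-1}).$$ 3. For every $\epsilon>0$, $$\sum_{(f_1,f_2,f_3)\in\mathcal F_g}\chi_P(f_1f_2)=\frac{C(g;P)}4\,q^{g+3}-(1-\eta_g)\left(2\sum_{\substack{f\text{ monic}\\ \deg f\in\{g+2,g+3\}}}\mu^2(f)\chi_P(f)+\frac{q+1}{q}\,\frac{q^{g+3}}{\zeta_q(2)}\right)+O\!\left(q^{(\frac12+\epsilon)g}\right)\qquad(g\ge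 0),$$ where $$C(g;P)=\frac{q+3}{q}L(q^{-1},\chi_P^+)^2H_{P,+}(q^{-1})+\frac{q-1}{q}L(q^{-1},\chi_P^-)^2H_{P,-}(q^{-1})-2(-1)^g\,\frac{q+1}{q}L(q^{-1},\chi_P^+)L(q^{-1},\chi_P^-)H_{P,0}(q^{-1}).$$ The implied constants depend only on $q$, $P$ and $\epsilon$ (and, in 2, on $k_1,k_2$). -/

import Mathlib

open Polynomial

namespace Biquad

variable (K : Type*) [Field K] [Fintype K]

theorem finite_natDegree_le (n : ℕ) : {f : K[X] | f.natDegree ≤ n}.Finite := by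
  have hfin : Finite (degreeLT K (n + 1)) :=
    Finite.of_equiv _ (degreeLTEquiv K (n + 1)).toEquiv.symm
  refine Set.Finite.subset (s := ((degreeLT K (n + 1) : Submodule K K[X]) : Set K[X]))
    (Set.toFinite _) ?_
  intro f hf
  have hf' : f.natDegree ≤ n := hf
  simp only [SetLike.mem_coe, mem_degreeLT]
  exact lt_of_le_of_lt degree_le_natDegree (by exact_mod_cast Nat.lt_succ_of_le hf')

theorem finite_triples (n : ℕ) (S : Set (K[X] × K[X] × K[X]))
    (hS : ∀ t ∈ S, t.1.natDegree + t.2.1.natDegree + t.2.2.natDegree ≤ n) : S.Finite := by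
  have h := finite_natDegree_le K n
  refine (h.prod (h.prod h)).subset ?_
  rintro ⟨a, b, c⟩ ht
  have := hS _ ht
  simp only [Set.mem_prod, Set.mem_ofPred_eq] at this ⊢
  omega

theorem finite_monic_natDegree (d : ℕ) : {f : K[X] | f.Monic ∧ f.natDegree = d}.Finite :=
  (finite_natDegree_le K d).subset fun _ hf => hf.2.le

/-- The finite set of monic polynomials of degree `d` over `K`. -/
noncomputable def monics (d : ℕ) : Finset K[X] := (finite_monic_natDegree K d).toFinset

theorem mem_monics {d : ℕ} {f : K[X]} : f ∈ monics K d ↔ f.Monic ∧ f.natDegree = d := by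
  simp [monics]

/-- The monic prime (irreducible) polynomials over `K`. -/
abbrev MonicPrime : Type _ := {Q : K[X] // Q.Monic ∧ Irreducible Q}

variable {K}

open Classical in
/-- The quadratic residue symbol `χ_P(F) = (F / P)`: `0` if `P ∣ F`, `1` if `F` is a non-zero
square modulo `P`, and `-1` otherwise. -/
noncomputable def chi (P F : K[X]) : ℂ :=
  ((quadraticCharFun (AdjoinRoot P) (AdjoinRoot.mk P F) : ℤ) : ℂ)

/-- The twist `χ_P^-(F) = (-1)^{deg F} χ_P(F)`. -/
noncomputable def chiMinus (P F : K[X]) : ℂ := (-1) ^ F.natDegree * chi P F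

open Classical in
/-- `μ²`, the indicator function of the square-free polynomials. -/
noncomputable def muSq (F : K[X]) : ℂ := if Squarefree F then 1 else 0

/-- The series `∑_F a(F) u^{deg F}` over monic `F`, arranged as a power series in `u`. -/
noncomputable def genSeries (a : K[X] → ℂ) (u : ℂ) : ℂ :=
  ∑' d : ℕ, (∑ F ∈ monics K d, a F) * u ^ d

/-- The `L`-function `L(u, χ)`. For `χ = χ_P^±` the coefficients of degree at least `deg P` vanish,
so that this is the polynomial which continues the Dirichlet series to all `u`. -/
noncomputable def LFun (χ : K[X] → ℂ) (u : ℂ) : ℂ := genSeries χ u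

variable (K) in
/-- The zeta function `Z(u)` of the affine line over `K`, for `|u| < 1/q`. -/
noncomputable def Z (u : ℂ) : ℂ := genSeries (fun _ : K[X] => 1) u

variable (K) in
/-- `ζ_q(s) = Z(q^{-s})`. -/
noncomputable def zetaQ (s : ℂ) : ℂ := Z K ((Fintype.card K : ℂ) ^ (-s))

/-- The local factor at `Q` of `H_{P,±}(u)`, with `χ = χ_P^±`. It is the quotient of the local
factor of `∏_Q (1 + u^{deg Q} + 2 χ(Q) u^{deg Q})` by that of `Z(u) L(u, χ)²`. -/
noncomputable def HpmFactor (χ : K[X] → ℂ) (u : ℂ) (Q : MonicPrime K) : ℂ :=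
  (1 + u ^ Q.1.natDegree + 2 * χ Q.1 * u ^ Q.1.natDegree) *
    (1 - u ^ Q.1.natDegree) * (1 - χ Q.1 * u ^ Q.1.natDegree) ^ 2

/-- `H_{P,±}(u)`, with `χ = χ_P^±`. -/
noncomputable def Hpm (χ : K[X] → ℂ) (u : ℂ) : ℂ := ∏' Q : MonicPrime K, HpmFactor χ u Q

/-- The local factor at `Q` of `H_{P,0}(u)`. It is the quotient of the local factor of
`∏_Q (1 + ((-1)^{deg Q} + χ_P^+(Q) + χ_P^-(Q)) u^{deg Q})` by that of
`Z(-u) L(u, χ_P^+) L(u, χ_P^-)`. -/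
noncomputable def HzeroFactor (P : K[X]) (u : ℂ) (Q : MonicPrime K) : ℂ :=
  (1 + ((-1) ^ Q.1.natDegree + chi P Q.1 + chiMinus P Q.1) * u ^ Q.1.natDegree) *
    (1 - (-u) ^ Q.1.natDegree) *
    (1 - chi P Q.1 * u ^ Q.1.natDegree) * (1 - chiMinus P Q.1 * u ^ Q.1.natDegree)

/-- `H_{P,0}(u)`. -/
noncomputable def Hzero (P : K[X]) (u : ℂ) : ℂ := ∏' Q : MonicPrime K, HzeroFactor P u Q

/-- The numerical function `L(d₁, d₂, d₃)` of the genus formula `g + 3 = L(d₁, d₂, d₃)`. -/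
def genusL (d₁ d₂ d₃ : ℕ) : ℕ :=
  d₁ + d₂ + d₃ + if (d₁ + d₃) % 2 = 0 ∧ (d₂ + d₃) % 2 = 0 then 0 else 1

variable (K) in
/-- The set `F̂_g` of triples parametrizing the biquadratic curves of genus `g`. -/
def FgHat (g : ℕ) : Set (K[X] × K[X] × K[X]) :=
  {t | Squarefree t.1 ∧ Squarefree t.2.1 ∧ Squarefree t.2.2 ∧
    IsCoprime t.1 t.2.1 ∧ IsCoprime t.1 t.2.2 ∧ IsCoprime t.2.1 t.2.2 ∧
    t.2.2.Monic ∧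
    genusL t.1.natDegree t.2.1.natDegree t.2.2.natDegree = g + 3 ∧
    ({t.1.natDegree, t.2.1.natDegree, t.2.2.natDegree} : Multiset ℕ) ≠ {g + 3, 0, 0} ∧
    ({t.1.natDegree, t.2.1.natDegree, t.2.2.natDegree} : Multiset ℕ) ≠ {g + 2, 0, 0}}

variable (K) in
/-- The set `F_g` of the triples of monic polynomials in `F̂_g`. -/
def Fg (g : ℕ) : Set (K[X] × K[X] × K[X]) :=
  {t | t ∈ FgHat K g ∧ t.1.Monic ∧ t.2.1.Monic ∧ t.2.2.Monic}

variable (K) in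
theorem Fg_finite (g : ℕ) : (Fg K g).Finite := by
  refine finite_triples K (g + 3) _ ?_
  rintro t ⟨⟨-, -, -, -, -, -, -, h, -⟩, -⟩
  rw [← h, genusL]
  omega

variable (K) in
/-- The triples of monic polynomials over which `N_{k₁,k₂}(d;P)` is summed. -/
def parityTriples (k₁ k₂ d : ℕ) : Set (K[X] × K[X] × K[X]) :=
  {t | t.1.Monic ∧ t.2.1.Monic ∧ t.2.2.Monic ∧
    (t.1 * t.2.1 * t.2.2).natDegree = d ∧
    (t.1 * t.2.2).natDegree ≡ k₁ [MOD 2] ∧ (t.2.1 * t.2.2).natDegree ≡ k₂ [MOD 2]}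

variable (K) in
theorem parityTriples_finite (k₁ k₂ d : ℕ) : (parityTriples K k₁ k₂ d).Finite := by
  refine finite_triples K d _ ?_
  rintro t ⟨h1, h2, h3, h, -⟩
  rw [(h1.mul h2).natDegree_mul h3, h1.natDegree_mul h2] at h
  exact h.le

/-- `N_{k₁,k₂}(d;P) = ∑ μ²(f₁f₂f₃) χ_P(f₁f₂)`. -/
noncomputable def N (P : K[X]) (k₁ k₂ d : ℕ) : ℂ :=
  ∑ t ∈ (parityTriples_finite K k₁ k₂ d).toFinset,
    muSq (t.1 * t.2.1 * t.2.2) * chi P (t.1 * t.2.1)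

/-- `∑_{(f₁,f₂,f₃) ∈ F_g} χ_P(f₁f₂)`. -/
noncomputable def sumFg (P : K[X]) (g : ℕ) : ℂ :=
  ∑ t ∈ (Fg_finite K g).toFinset, chi P (t.1 * t.2.1)

/-- The constant `C_{k₁,k₂}(d;P)`. -/
noncomputable def Ck (P : K[X]) (k₁ k₂ d : ℕ) : ℂ :=
  let v : ℂ := (Fintype.card K : ℂ)⁻¹
  LFun (chi P) v ^ 2 * Hpm (chi P) v +
    (-1) ^ (k₁ + k₂) * LFun (chiMinus P) v ^ 2 * Hpm (chiMinus P) v +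
    (-1) ^ d * ((-1) ^ k₁ + (-1) ^ k₂) * LFun (chi P) v * LFun (chiMinus P) v * Hzero P v

/-- The constant `C(g;P)`. -/
noncomputable def C (P : K[X]) (g : ℕ) : ℂ :=
  let q : ℂ := Fintype.card K
  (q + 3) / q * LFun (chi P) q⁻¹ ^ 2 * Hpm (chi P) q⁻¹ +
    (q - 1) / q * LFun (chiMinus P) q⁻¹ ^ 2 * Hpm (chiMinus P) q⁻¹ -
    2 * (-1) ^ g * ((q + 1) / q) * LFun (chi P) q⁻¹ * LFun (chiMinus P) q⁻¹ * Hzero P q⁻¹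

/-- `η_n = 1` for even `n` and `η_n = 0` for odd `n`. -/
def eta (n : ℕ) : ℂ := if Even n then 1 else 0

/-- The sum `∑_{deg f = d} μ²(f) χ_P(f)` over monic `f`. -/
noncomputable def sqfreeCharSum (P : K[X]) (d : ℕ) : ℂ := ∑ f ∈ monics K d, muSq f * chi P f

end Biquad

/-! ### Euler products over the monic primes. -/

namespace Biquad

variable {K : Type*} [Field K] [Fintype K]

/-! A triple of monic polynomials with square-free product `F` is an ordered partition of the primes
of `F` into three classes. So for completely multiplicative `ψ₁, ψ₂`, the sums of `ψ₁(f₁)ψ₂(f₂)`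
over such triples of degree `d` are the coefficients of `∏_Q (1 + (1 + ψ₁(Q) + ψ₂(Q)) u^{deg Q})`
(`sum_sqfTriples`, `hasSum_sqfMonics`). This product equals `Z(u) L(u,ψ₁) L(u,ψ₂)` times a
correction product whose local factors are `1 + O(u^{2 deg Q})`, holomorphic for `|u| < q^{-1/2}`
(`tprod_mul_one_sub`, `differentiableOn_tprod_localFactor`). For `ψᵢ ∈ {χ_P^+, χ_P^-}` both
`L`-functions are polynomials (`sum_chi_eq_zero`), so `Z(u) = 1/(1 - qu)` contributes the only
possible pole in that disc. Removing it and applying Cauchy's bound gives a main term `c q^d` with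
error `O(q^{(1/2+ε)d})` (`coeff_asymptotic`).

Detecting the two parities in `N_{k₁,k₂}` by signs produces exactly the four choices of `(ψ₁, ψ₂)`,
because the signs `(-1)^{deg f}` turn `χ_P^+` into `χ_P^-` (`N_eq`).

For `F_g`, the genus condition means total degree `g+3` when both parities are even and `g+2`
otherwise. The sum is therefore `N_{0,0}(g+3) + N_{0,1}(g+2) + N_{1,0}(g+2) + N_{1,1}(g+2)`, less
the excluded triples. These satisfy the parity condition only for odd `g`, and their sum is known
exactly from the count of square-free polynomials (`sumFg_eq`, `card_sqfMonics`). -/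

theorem hasSum_sum_fiber {β : Type*} {f : β → ℂ} (hf : Summable f) (g : β → ℕ)
    (S : ℕ → Finset β) (hS : ∀ d b, b ∈ S d ↔ g b = d) :
    HasSum (fun d => ∑ b ∈ S d, f b) (∑' b, f b) := by
  have h := hf.hasSum.tsum_fiberwise g
  have h2 : ∀ d, ∑' b : (g ⁻¹' {d}), f b = ∑ b ∈ S d, f b := fun d => by
    have : g ⁻¹' {d} = (↑(S d) : Set β) := by ext b; simp [hS]
    rw [this]
    exact Finset.tsum_subtype' (S d) f
  simpa only [h2] using h

theorem card_monics (d : ℕ) : (monics K d).card = Fintype.card K ^ d := by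
  have e1 : {f : K[X] // f ∈ monics K d} ≃ (Fin d → K) :=
    (Equiv.subtypeEquivRight fun f => mem_monics K).trans
      ((monicEquivDegreeLT d).trans (degreeLTEquiv K d).toEquiv)
  have := Fintype.card_congr e1
  simpa using this

variable (K) in
/-- The monic polynomials over `K`. -/
abbrev MonicPoly : Type _ := {F : K[X] // F.Monic}

variable (K) in
/-- The monic polynomials of degree `d`, as a finite set of elements of `MonicPoly K`. -/
noncomputable def monicsSub (d : ℕ) : Finset (MonicPoly K) := by
  classical exact (monics K d).subtype Monic

theorem mem_monicsSub {d : ℕ} {F : MonicPoly K} : F ∈ monicsSub K d ↔ F.1.natDegree = d := by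
  simp [monicsSub, mem_monics, F.2]

theorem sum_monicsSub (d : ℕ) (f : K[X] → ℂ) :
    ∑ F ∈ monicsSub K d, f F.1 = ∑ F ∈ monics K d, f F := by
  classical
  have h := Finset.sum_subtype_eq_sum_filter (s := monics K d) (p := Monic) f
  rw [Finset.filter_true_of_mem (fun x hx => ((mem_monics K).1 hx).1)] at h
  rw [← h]
  simp only [monicsSub]

theorem card_monicsSub (d : ℕ) : (monicsSub K d).card = Fintype.card K ^ d := by
  have := sum_monicsSub (K := K) d (fun _ => 1)
  simp only [Finset.sum_const, nsmul_eq_mul, mul_one] at this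
  rw [← card_monics (K := K) d]
  exact_mod_cast this

theorem summable_pow_natDegree {ρ : ℝ} (h0 : 0 ≤ ρ) (h1 : Fintype.card K * ρ < 1) :
    Summable fun F : MonicPoly K => ρ ^ F.1.natDegree := by
  rw [← (Equiv.sigmaFiberEquiv fun F : MonicPoly K => F.1.natDegree).summable_iff]
  have hfin : ∀ d, Finite {F : MonicPoly K // F.1.natDegree = d} := fun d =>
    Set.Finite.to_subtype ((monicsSub K d).finite_toSet.subset fun F hF => mem_monicsSub.2 hF)
  rw [summable_sigma_of_nonneg (fun x => by exact pow_nonneg h0 _)]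
  refine ⟨fun d => by have := hfin d; exact Summable.of_finite, ?_⟩
  refine (summable_geometric_of_lt_one (by positivity) h1).congr fun d => ?_
  have hd : ∀ x : {F : MonicPoly K // F.1.natDegree = d}, ((fun F : MonicPoly K =>
      ρ ^ F.1.natDegree) ∘ (Equiv.sigmaFiberEquiv fun F : MonicPoly K => F.1.natDegree)) ⟨d, x⟩
      = ρ ^ d := fun x => by
    simp [Equiv.sigmaFiberEquiv, x.2]
  simp_rw [hd, tsum_const, mul_pow, nsmul_eq_mul]
  rw [Nat.subtype_card (monicsSub K d) fun F => mem_monicsSub, card_monicsSub, Nat.cast_pow]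

theorem summable_prime_pow_natDegree {ρ : ℝ} (h0 : 0 ≤ ρ) (h1 : Fintype.card K * ρ < 1) :
    Summable fun Q : MonicPrime K => ρ ^ Q.1.natDegree :=
  (summable_pow_natDegree h0 h1).comp_injective
    (i := fun Q : MonicPrime K => (⟨Q.1, Q.2.1⟩ : MonicPoly K)) fun Q R h => by
      simpa [Subtype.ext_iff] using h

theorem summable_monic {ψ : K[X] → ℂ} {c : ℝ} (hψ : ∀ F, ‖ψ F‖ ≤ c) {u : ℂ}
    (hu : Fintype.card K * ‖u‖ < 1) :
    Summable fun F : MonicPoly K => ψ F.1 * u ^ F.1.natDegree := by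
  refine Summable.of_norm_bounded ((summable_pow_natDegree (norm_nonneg u) hu).mul_left c)
    fun F => ?_
  rw [norm_mul, norm_pow]
  exact mul_le_mul_of_nonneg_right (hψ _) (by positivity)

theorem summable_norm_prime {ψ : K[X] → ℂ} {c : ℝ} (hψ : ∀ F, ‖ψ F‖ ≤ c) {u : ℂ}
    (hu : Fintype.card K * ‖u‖ < 1) :
    Summable fun Q : MonicPrime K => ‖ψ Q.1 * u ^ Q.1.natDegree‖ := by
  refine Summable.of_nonneg_of_le (fun _ => norm_nonneg _) (fun F => ?_)
    ((summable_prime_pow_natDegree (norm_nonneg u) hu).mul_left c)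
  rw [norm_mul, norm_pow]
  exact mul_le_mul_of_nonneg_right (hψ _) (by positivity)

theorem hasSum_genSeries {ψ : K[X] → ℂ} {c : ℝ} (hψ : ∀ F, ‖ψ F‖ ≤ c) {u : ℂ}
    (hu : Fintype.card K * ‖u‖ < 1) :
    HasSum (fun d => (∑ F ∈ monics K d, ψ F) * u ^ d)
      (∑' F : MonicPoly K, ψ F.1 * u ^ F.1.natDegree) := by
  convert hasSum_sum_fiber (summable_monic hψ hu) (fun F => F.1.natDegree) (monicsSub K)
    (fun d b => mem_monicsSub) using 2 with d
  rw [sum_monicsSub d (fun F => ψ F * u ^ F.natDegree), Finset.sum_mul]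
  refine Finset.sum_congr rfl fun F hF => ?_
  rw [((mem_monics K).1 hF).2]

theorem genSeries_eq_tsum {ψ : K[X] → ℂ} {c : ℝ} (hψ : ∀ F, ‖ψ F‖ ≤ c) {u : ℂ}
    (hu : Fintype.card K * ‖u‖ < 1) :
    genSeries ψ u = ∑' F : MonicPoly K, ψ F.1 * u ^ F.1.natDegree :=
  (hasSum_genSeries hψ hu).tsum_eq

omit [Fintype K] in
theorem MonicPrime.eq_of_dvd {Q R : MonicPrime K} (h : Q.1 ∣ R.1) : Q = R :=
  Subtype.ext (eq_of_monic_of_associated Q.2.1 R.2.1 (Q.2.2.associated_of_dvd R.2.2 h))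

omit [Fintype K] in
theorem MonicPrime.prime (Q : MonicPrime K) : Prime Q.1 := Q.2.2.prime

omit [Fintype K] in
theorem exists_monicPrime_dvd {F : K[X]} (hF : F.Monic) (h1 : F ≠ 1) :
    ∃ Q : MonicPrime K, Q.1 ∣ F := by
  obtain ⟨R, hR, hm, hd⟩ := exists_monic_irreducible_factor F
    (fun h => h1 (hF.eq_one_of_isUnit h))
  exact ⟨⟨R, hR, hm⟩, hd⟩

open Classical in
-- Sieve of Eratosthenes, one prime at a time: the terms divisible by a new prime `R` are
-- parametrized by `G ↦ R G`, which pulls out the factor `ψ(R) u^{deg R}` and leaves the sum already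
-- sieved by `S`.
theorem sieve_tsum (ψ : K[X] →* ℂ) (hψ : ∀ F, ‖ψ F‖ ≤ 1) {u : ℂ}
    (hu : Fintype.card K * ‖u‖ < 1) (S : Finset (MonicPrime K)) :
    (∑' F : MonicPoly K, if ∀ Q ∈ S, ¬ Q.1 ∣ F.1 then ψ F.1 * u ^ F.1.natDegree else 0) =
      (∑' F : MonicPoly K, ψ F.1 * u ^ F.1.natDegree) *
        ∏ Q ∈ S, (1 - ψ Q.1 * u ^ Q.1.natDegree) := by
  have hsum := summable_monic hψ hu
  have hind : ∀ (p : MonicPoly K → Prop) [DecidablePred p], Summable fun F : MonicPoly K =>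
      if p F then ψ F.1 * u ^ F.1.natDegree else 0 := fun p _ =>
    Summable.of_norm_bounded hsum.norm fun F => by
      split_ifs
      · exact le_rfl
      · simp only [norm_zero]; positivity
  induction S using Finset.induction_on with
  | empty => simp
  | insert R S hR ih =>
    rw [Finset.prod_insert hR, mul_left_comm, ← ih, one_sub_mul, eq_sub_iff_add_eq, ← tsum_mul_left]
    have hinj : Function.Injective fun G : MonicPoly K =>
        (⟨R.1 * G.1, R.2.1.mul G.2⟩ : MonicPoly K) := fun G H h => by
      simpa [Subtype.ext_iff, R.2.1.ne_zero] using h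
    have key := hinj.tsum_eq (f := fun F : MonicPoly K =>
      if (∀ Q ∈ S, ¬ Q.1 ∣ F.1) ∧ R.1 ∣ F.1 then ψ F.1 * u ^ F.1.natDegree else 0) (by
        intro F hF
        rw [Function.mem_support] at hF
        have h2 : R.1 ∣ F.1 := by
          by_contra h
          simp [h] at hF
        obtain ⟨G, hG⟩ := h2
        exact ⟨⟨G, R.2.1.of_mul_monic_left (hG ▸ F.2)⟩, Subtype.ext hG.symm⟩)
    have h1 : ∀ G : MonicPoly K, (if (∀ Q ∈ S, ¬ Q.1 ∣ R.1 * G.1) ∧ R.1 ∣ R.1 * G.1 then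
        ψ (R.1 * G.1) * u ^ (R.1 * G.1).natDegree else 0) = ψ R.1 * u ^ R.1.natDegree *
        (if ∀ Q ∈ S, ¬ Q.1 ∣ G.1 then ψ G.1 * u ^ G.1.natDegree else 0) := by
      intro G
      -- Multiplying by `R` does not affect the sieve by `S`, since `R ∉ S` and distinct monic
      -- primes do not divide each other.
      have h3 : (∀ Q ∈ S, ¬ Q.1 ∣ R.1 * G.1) ↔ ∀ Q ∈ S, ¬ Q.1 ∣ G.1 := by
        refine forall₂_congr fun Q hQ => not_congr ?_
        rw [Q.prime.dvd_mul, or_iff_right]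
        intro h
        exact hR (MonicPrime.eq_of_dvd h ▸ hQ)
      simp only [h3, dvd_mul_right, and_true, map_mul, R.2.1.natDegree_mul G.2, pow_add]
      split_ifs <;> ring
    simp only [h1] at key
    rw [key]
    refine ((hind _).tsum_add (hind _)).symm.trans (tsum_congr fun F => ?_)
    by_cases hS : ∀ Q ∈ S, ¬ Q.1 ∣ F.1 <;> by_cases hRF : R.1 ∣ F.1 <;>
      simp only [Finset.forall_mem_insert, hS, hRF] <;> simp

/-- Let the sieving set grow to all primes. Every `F ≠ 1` is eventually removed, so by dominated
convergence only the term `F = 1` survives. This form of the Euler product also shows that neither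
factor vanishes. -/
theorem tsum_mul_tprod (ψ : K[X] →* ℂ) (hψ : ∀ F, ‖ψ F‖ ≤ 1) {u : ℂ}
    (hu : Fintype.card K * ‖u‖ < 1) :
    (∑' F : MonicPoly K, ψ F.1 * u ^ F.1.natDegree) *
      ∏' Q : MonicPrime K, (1 - ψ Q.1 * u ^ Q.1.natDegree) = 1 := by
  classical
  have hsum := summable_monic hψ hu
  have hm : Multipliable fun Q : MonicPrime K => (1 - ψ Q.1 * u ^ Q.1.natDegree) := by
    simp only [sub_eq_add_neg]
    exact multipliable_one_add_of_summable (by simpa only [norm_neg] using summable_norm_prime hψ hu)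
  have h1 : Filter.Tendsto (fun S : Finset (MonicPrime K) => ∑' F : MonicPoly K,
      if ∀ Q ∈ S, ¬ Q.1 ∣ F.1 then ψ F.1 * u ^ F.1.natDegree else 0) Filter.atTop
      (nhds (∑' F : MonicPoly K, if F = ⟨1, monic_one⟩ then 1 else 0)) := by
    refine tendsto_tsum_of_dominated_convergence hsum.norm (fun F => ?_)
      (Filter.Eventually.of_forall fun S F => ?_)
    · by_cases hF : F = ⟨1, monic_one⟩
      · have : ∀ Q : MonicPrime K, ¬ Q.1 ∣ 1 := fun Q h => Q.2.2.not_isUnit (isUnit_of_dvd_one h)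
        simp [hF, this]
      · obtain ⟨R, hR⟩ := exists_monicPrime_dvd F.2 fun h => hF (Subtype.ext h)
        rw [if_neg hF]
        refine tendsto_const_nhds.congr' ?_
        filter_upwards [Filter.eventually_ge_atTop {R}] with S hS
        rw [if_neg]
        exact fun h => h R (by simpa using hS) hR
    · split_ifs
      · exact le_rfl
      · simp only [norm_zero]; positivity
  rw [tsum_ite_eq] at h1
  have h2 := hm.hasProd
  rw [HasProd, SummationFilter.unconditional_filter] at h2
  refine tendsto_nhds_unique (h2.const_mul _) ?_
  simpa only [sieve_tsum ψ hψ hu] using h1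

end Biquad

/-! ### Square-free polynomials as finite sets of primes. -/

namespace Biquad

variable {K : Type*} [Field K]

open Classical in
/-- The monic primes dividing a non-zero polynomial. -/
noncomputable def primeDivisors (F : K[X]) : Finset (MonicPrime K) :=
  (UniqueFactorizationMonoid.normalizedFactors F).toFinset.subtype _

theorem mem_primeDivisors {F : K[X]} (hF : F ≠ 0) {Q : MonicPrime K} :
    Q ∈ primeDivisors F ↔ Q.1 ∣ F := by
  classical
  rw [primeDivisors, Finset.mem_subtype, Multiset.mem_toFinset,
    Polynomial.mem_normalizedFactors_iff hF]
  simp [Q.2.1, Q.2.2]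

theorem monic_prod_primes (s : Finset (MonicPrime K)) : (∏ Q ∈ s, Q.1).Monic :=
  monic_prod_of_monic _ _ fun Q _ => Q.2.1

theorem squarefree_prod_primes (s : Finset (MonicPrime K)) : Squarefree (∏ Q ∈ s, Q.1) := by
  refine Finset.squarefree_prod_of_pairwise_isCoprime ?_ fun Q _ => Q.2.2.squarefree
  intro Q _ R _ h
  exact (Q.2.2.isRelPrime_iff_not_dvd).2 fun hd => h (MonicPrime.eq_of_dvd hd)

theorem primeDivisors_prod (s : Finset (MonicPrime K)) : primeDivisors (∏ Q ∈ s, Q.1) = s := by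
  ext R
  rw [mem_primeDivisors (monic_prod_primes s).ne_zero, R.prime.dvd_finsetProd_iff]
  constructor
  · rintro ⟨Q, hQ, h⟩
    exact MonicPrime.eq_of_dvd h ▸ hQ
  · exact fun h => ⟨R, h, dvd_rfl⟩

theorem prod_primeDivisors {F : K[X]} (hF : F.Monic) (hs : Squarefree F) :
    ∏ Q ∈ primeDivisors F, Q.1 = F := by
  classical
  have hn := (UniqueFactorizationMonoid.squarefree_iff_nodup_normalizedFactors hF.ne_zero).1 hs
  have hmem : ∀ Q ∈ (UniqueFactorizationMonoid.normalizedFactors F).toFinset,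
      Q.Monic ∧ Irreducible Q := fun Q hQ => by
    rw [Multiset.mem_toFinset, Polynomial.mem_normalizedFactors_iff hF.ne_zero] at hQ
    exact ⟨hQ.2.1, hQ.1⟩
  have h1 := Finset.prod_subtype_of_mem (s := (UniqueFactorizationMonoid.normalizedFactors
    F).toFinset) (fun Q : K[X] => Q) hmem
  have h2 : (UniqueFactorizationMonoid.normalizedFactors F).prod = F :=
    eq_of_monic_of_associated (by
      simpa using monic_multiset_prod_of_monic _ id fun Q hQ =>
        (hmem Q (Multiset.mem_toFinset.2 hQ)).1) hF
      (UniqueFactorizationMonoid.prod_normalizedFactors hF.ne_zero)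
  have h3 := Finset.prod_val (UniqueFactorizationMonoid.normalizedFactors F).toFinset
  rw [Multiset.toFinset_val, hn.dedup, h2] at h3
  refine Eq.trans ?_ (h1.trans h3.symm)
  unfold primeDivisors
  congr!

theorem primeDivisors_mul {F G : K[X]} (hF : F ≠ 0) (hG : G ≠ 0) {Q : MonicPrime K} :
    Q ∈ primeDivisors (F * G) ↔ Q ∈ primeDivisors F ∨ Q ∈ primeDivisors G := by
  rw [mem_primeDivisors (mul_ne_zero hF hG), mem_primeDivisors hF, mem_primeDivisors hG,
    Q.prime.dvd_mul]

theorem disjoint_primeDivisors {F G : K[X]} (h : Squarefree (F * G)) :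
    Disjoint (primeDivisors F) (primeDivisors G) := by
  have h0 := h.ne_zero
  rw [Finset.disjoint_left]
  intro Q h1 h2
  rw [mem_primeDivisors (left_ne_zero_of_mul h0)] at h1
  rw [mem_primeDivisors (right_ne_zero_of_mul h0)] at h2
  exact Q.2.2.not_isUnit (h Q.1 (mul_dvd_mul h1 h2))

variable [Fintype K]

variable (K) in
open Classical in
/-- The square-free monic polynomials of degree `d`. -/
noncomputable def sqfMonics (d : ℕ) : Finset K[X] := (monics K d).filter Squarefree

theorem mem_sqfMonics {d : ℕ} {F : K[X]} :
    F ∈ sqfMonics K d ↔ F.Monic ∧ F.natDegree = d ∧ Squarefree F := by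
  simp [sqfMonics, mem_monics, and_assoc]

omit [Fintype K] in
theorem prod_pow_natDegree (a : MonicPrime K → ℂ) (u : ℂ) {F : K[X]} (hF : F.Monic)
    (hs : Squarefree F) : ∏ Q ∈ primeDivisors F, a Q * u ^ Q.1.natDegree =
      (∏ Q ∈ primeDivisors F, a Q) * u ^ F.natDegree := by
  conv_rhs => rw [← prod_primeDivisors hF hs]
  rw [primeDivisors_prod, natDegree_prod_of_monic _ _ fun Q _ => Q.2.1,
    ← Finset.prod_pow_eq_pow_sum, Finset.prod_mul_distrib]

/-- Expanding the product gives a sum over finite sets of primes; these correspond to square-free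
monic polynomials, which are then grouped by degree. -/
theorem hasSum_sqfMonics (a : MonicPrime K → ℂ) {c : ℝ} (ha : ∀ Q, ‖a Q‖ ≤ c) {u : ℂ}
    (hu : Fintype.card K * ‖u‖ < 1) :
    HasSum (fun d => (∑ F ∈ sqfMonics K d, ∏ Q ∈ primeDivisors F, a Q) * u ^ d)
      (∏' Q : MonicPrime K, (1 + a Q * u ^ Q.1.natDegree)) := by
  classical
  have hsum : Summable fun Q : MonicPrime K => ‖a Q * u ^ Q.1.natDegree‖ := by
    refine Summable.of_nonneg_of_le (fun _ => norm_nonneg _) (fun F => ?_)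
      ((summable_prime_pow_natDegree (norm_nonneg u) hu).mul_left c)
    rw [norm_mul, norm_pow]
    exact mul_le_mul_of_nonneg_right (ha _) (by positivity)
  have hs := summable_finsetProd_of_summable_norm hsum
  rw [tprod_one_add hs]
  have h := hasSum_sum_fiber hs (fun s => (∏ Q ∈ s, Q.1).natDegree)
    (fun d => (sqfMonics K d).image primeDivisors) (fun d s => by
      simp only [Finset.mem_image, mem_sqfMonics]
      constructor
      · rintro ⟨F, ⟨h1, h2, h3⟩, rfl⟩
        rwa [prod_primeDivisors h1 h3]
      · intro h
        exact ⟨_, ⟨monic_prod_primes s, h, squarefree_prod_primes s⟩, primeDivisors_prod s⟩)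
  refine h.congr_fun fun d => ?_
  rw [Finset.sum_image, Finset.sum_mul]
  · refine Finset.sum_congr rfl fun F hF => ?_
    rw [mem_sqfMonics] at hF
    rw [prod_pow_natDegree a u hF.1 hF.2.2, hF.2.1]
  · intro F hF G hG h
    rw [Finset.mem_coe, mem_sqfMonics] at hF hG
    rw [← prod_primeDivisors hF.1 hF.2.2, h, prod_primeDivisors hG.1 hG.2.2]

variable (K) in
/-- The triples of monic polynomials with square-free product of degree `d`. -/
def sqfTriplesSet (d : ℕ) : Set (K[X] × K[X] × K[X]) :=
  {t | t.1.Monic ∧ t.2.1.Monic ∧ t.2.2.Monic ∧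
    t.1.natDegree + t.2.1.natDegree + t.2.2.natDegree = d ∧ Squarefree (t.1 * t.2.1 * t.2.2)}

variable (K) in
/-- The triples of monic polynomials with square-free product of degree `d`, as a finite set. -/
noncomputable def sqfTriples (d : ℕ) : Finset (K[X] × K[X] × K[X]) :=
  (finite_triples K d (sqfTriplesSet K d) fun _ ht => ht.2.2.2.1.le).toFinset

theorem mem_sqfTriples {d : ℕ} {t : K[X] × K[X] × K[X]} :
    t ∈ sqfTriples K d ↔ t.1.Monic ∧ t.2.1.Monic ∧ t.2.2.Monic ∧
      t.1.natDegree + t.2.1.natDegree + t.2.2.natDegree = d ∧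
      Squarefree (t.1 * t.2.1 * t.2.2) := by
  rw [sqfTriples, Set.Finite.mem_toFinset]
  rfl

/-- Expanding `∏ (ψ₁ + (ψ₂ + 1))` assigns each prime of `F` to `f₁`, `f₂` or `f₃`, the summand `1`
standing for `f₃`. Square-freeness makes the three classes disjoint and recovers the triple from
them. -/
theorem sum_sqfTriples (ψ₁ ψ₂ : K[X] →* ℂ) (d : ℕ) :
    ∑ t ∈ sqfTriples K d, ψ₁ t.1 * ψ₂ t.2.1 =
      ∑ F ∈ sqfMonics K d, ∏ Q ∈ primeDivisors F, (1 + ψ₁ Q.1 + ψ₂ Q.1) := by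
  classical
  have h1 : ∀ F : K[X], ∏ Q ∈ primeDivisors F, (1 + ψ₁ Q.1 + ψ₂ Q.1) =
      ∑ p ∈ (primeDivisors F).powerset.sigma fun a => (primeDivisors F \ a).powerset,
        ψ₁ (∏ Q ∈ p.1, Q.1) * ψ₂ (∏ Q ∈ p.2, Q.1) := by
    intro F
    simp_rw [show ∀ Q : MonicPrime K, 1 + ψ₁ Q.1 + ψ₂ Q.1 = ψ₁ Q.1 + (ψ₂ Q.1 + 1) from
      fun Q => by ring]
    rw [Finset.prod_add, Finset.sum_sigma]
    refine Finset.sum_congr rfl fun a _ => ?_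
    rw [Finset.prod_add, Finset.mul_sum]
    refine Finset.sum_congr rfl fun b _ => ?_
    simp [map_prod]
  simp_rw [h1]
  rw [Finset.sum_sigma']
  refine Finset.sum_bij' (fun t _ => ⟨t.1 * t.2.1 * t.2.2, primeDivisors t.1, primeDivisors t.2.1⟩)
    (fun x _ => (∏ Q ∈ x.2.1, Q.1, ∏ Q ∈ x.2.2, Q.1, ∏ Q ∈ (primeDivisors x.1 \ x.2.1) \ x.2.2, Q.1))
    ?_ ?_ ?_ ?_ ?_
  · rintro ⟨f, g, h⟩ ht
    obtain ⟨hf, hg, hh, hd, hs⟩ := mem_sqfTriples.1 ht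
    simp only at hf hg hh hd hs
    simp only [Finset.mem_sigma, mem_sqfMonics, Finset.mem_powerset]
    refine ⟨⟨(hf.mul hg).mul hh, ?_, hs⟩, ?_, ?_⟩
    · rw [(hf.mul hg).natDegree_mul hh, hf.natDegree_mul hg, hd]
    · intro Q hQ
      simp [primeDivisors_mul, hf.ne_zero, hg.ne_zero, hh.ne_zero, hQ]
    · intro Q hQ
      have := Finset.disjoint_right.1 (disjoint_primeDivisors hs.of_mul_left) hQ
      simp [primeDivisors_mul, hf.ne_zero, hg.ne_zero, hh.ne_zero, hQ, this]
  · rintro ⟨F, a, b⟩ hx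
    simp only [Finset.mem_sigma, mem_sqfMonics, Finset.mem_powerset] at hx
    obtain ⟨⟨hF, hd, hs⟩, ha, hb⟩ := hx
    have hprod : (∏ Q ∈ a, Q.1) * (∏ Q ∈ b, Q.1) * ∏ Q ∈ (primeDivisors F \ a) \ b, Q.1 = F := by
      rw [mul_assoc, mul_comm (∏ Q ∈ b, Q.1), Finset.prod_sdiff hb, mul_comm,
        Finset.prod_sdiff ha, prod_primeDivisors hF hs]
    rw [mem_sqfTriples]
    refine ⟨monic_prod_primes _, monic_prod_primes _, monic_prod_primes _, ?_, ?_⟩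
    · rw [← (monic_prod_primes _).natDegree_mul (monic_prod_primes _),
        ← ((monic_prod_primes _).mul (monic_prod_primes _)).natDegree_mul (monic_prod_primes _),
        hprod, hd]
    · simp only [hprod, hs]
  · rintro ⟨f, g, h⟩ ht
    obtain ⟨hf, hg, hh, hd, hs⟩ := mem_sqfTriples.1 ht
    simp only at hf hg hh hd hs
    have hs' : Squarefree (f * h * g) := by rwa [mul_right_comm]
    have hfh := hs'.of_mul_left
    have hgh : Squarefree (g * h) := by rw [mul_assoc] at hs; exact hs.of_mul_right
    have hpd : (primeDivisors (f * g * h) \ primeDivisors f) \ primeDivisors g =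
        primeDivisors h := by
      ext Q
      have h1 : Q ∈ primeDivisors h → Q ∉ primeDivisors f := fun h1 =>
        Finset.disjoint_right.1 (disjoint_primeDivisors hfh) h1
      have h2 : Q ∈ primeDivisors h → Q ∉ primeDivisors g := fun h1 =>
        Finset.disjoint_right.1 (disjoint_primeDivisors hgh) h1
      simp only [Finset.mem_sdiff, primeDivisors_mul (mul_ne_zero hf.ne_zero hg.ne_zero) hh.ne_zero,
        primeDivisors_mul hf.ne_zero hg.ne_zero]
      tauto
    simp only [hpd]
    rw [prod_primeDivisors hf hfh.of_mul_left, prod_primeDivisors hg hgh.of_mul_left,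
      prod_primeDivisors hh hgh.of_mul_right]
  · rintro ⟨F, a, b⟩ hx
    simp only [Finset.mem_sigma, mem_sqfMonics, Finset.mem_powerset] at hx
    obtain ⟨⟨hF, hd, hs⟩, ha, hb⟩ := hx
    have hprod : (∏ Q ∈ a, Q.1) * (∏ Q ∈ b, Q.1) * ∏ Q ∈ (primeDivisors F \ a) \ b, Q.1 = F := by
      rw [mul_assoc, mul_comm (∏ Q ∈ b, Q.1), Finset.prod_sdiff hb, mul_comm,
        Finset.prod_sdiff ha, prod_primeDivisors hF hs]
    simp only [hprod, primeDivisors_prod]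
  · rintro ⟨f, g, h⟩ ht
    obtain ⟨hf, hg, hh, hd, hs⟩ := mem_sqfTriples.1 ht
    simp only at hf hg hh hd hs ⊢
    rw [prod_primeDivisors hf hs.of_mul_left.of_mul_left,
      prod_primeDivisors hg hs.of_mul_left.of_mul_right]

end Biquad

/-! ### Coefficient asymptotics and the correction product. -/

namespace Biquad

theorem hasFPowerSeriesAt_ofScalars {f : ℂ → ℂ} {S : ℕ → ℂ}
    (h : ∀ᶠ u in nhds (0 : ℂ), HasSum (fun d => S d * u ^ d) (f u)) :
    HasFPowerSeriesAt f (FormalMultilinearSeries.ofScalars ℂ S) 0 := by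
  rw [hasFPowerSeriesAt_iff]
  filter_upwards [h] with u hu
  simpa [FormalMultilinearSeries.coeff_ofScalars, mul_comm] using hu

theorem coeff_unique {f : ℂ → ℂ} {S T : ℕ → ℂ}
    (hS : ∀ᶠ u in nhds (0 : ℂ), HasSum (fun d => S d * u ^ d) (f u))
    (hT : ∀ᶠ u in nhds (0 : ℂ), HasSum (fun d => T d * u ^ d) (f u)) : S = T := by
  have h := (hasFPowerSeriesAt_ofScalars hS).eq_formalMultilinearSeries
    (hasFPowerSeriesAt_ofScalars hT)
  funext d
  simpa [FormalMultilinearSeries.coeff_ofScalars] using congrArg (fun p => p.coeff d) h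

theorem coeff_bound {f : ℂ → ℂ} {S : ℕ → ℂ} {r : ℝ} (hr : 0 < r)
    (hf : DifferentiableOn ℂ f (Metric.closedBall 0 r))
    (hS : ∀ᶠ u in nhds (0 : ℂ), HasSum (fun d => S d * u ^ d) (f u)) :
    ∃ A, ∀ d, ‖S d‖ ≤ A * r⁻¹ ^ d := by
  lift r to NNReal using hr.le
  have h1 := (hf.hasFPowerSeriesOnBall (by exact_mod_cast hr)).hasFPowerSeriesAt
  have h := (hasFPowerSeriesAt_ofScalars hS).eq_formalMultilinearSeries h1
  have h2 := norm_cauchyPowerSeries_le f 0 r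
  simp only [← h, FormalMultilinearSeries.ofScalars_norm, abs_of_pos hr] at h2
  exact ⟨_, h2⟩

/-- With `c = 1/q`, subtracting the polar part `G(c)/(1 - qu)` from `D = G/(1 - qu)` leaves `-c
(G(u) - G(c))/(u - c)`. The singularity at `c` is removable, so the remainder is holomorphic
wherever `G` is, and Cauchy's bound applies on circles beyond `|u| = 1/q`. -/
theorem coeff_asymptotic {q : ℝ} (hq : 1 < q) {T : ℕ → ℂ} {G D : ℂ → ℂ}
    (hG : DifferentiableOn ℂ G {u : ℂ | q * ‖u‖ ^ 2 < 1})
    (hT : ∀ u : ℂ, q * ‖u‖ < 1 → HasSum (fun d => T d * u ^ d) (D u))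
    (hD : ∀ u : ℂ, q * ‖u‖ < 1 → D u * (1 - q * u) = G u) {ε : ℝ} (hε : 0 < ε) :
    ∃ A : ℝ, ∀ d : ℕ, ‖T d - G (q : ℂ)⁻¹ * (q : ℂ) ^ d‖ ≤ A * q ^ ((1 / 2 + ε) * (d : ℝ)) := by
  have hq0 : 0 < q := by linarith
  have hqc : (q : ℂ) ≠ 0 := by exact_mod_cast hq0.ne'
  set c : ℂ := (q : ℂ)⁻¹ with hc
  have hopen : IsOpen {u : ℂ | q * ‖u‖ ^ 2 < 1} := isOpen_lt (by fun_prop) (by fun_prop)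
  have hcmem : {u : ℂ | q * ‖u‖ ^ 2 < 1} ∈ nhds c := by
    refine hopen.mem_nhds ?_
    have : ‖c‖ = q⁻¹ := by rw [hc, norm_inv, Complex.norm_real, Real.norm_of_nonneg hq0.le]
    simp only [Set.mem_ofPred_eq, this]
    rw [show q * q⁻¹ ^ 2 = q⁻¹ by field_simp]
    exact inv_lt_one_of_one_lt₀ hq
  have hE : DifferentiableOn ℂ (fun u => -c * dslope G c u) {u : ℂ | q * ‖u‖ ^ 2 < 1} :=
    ((Complex.differentiableOn_dslope hcmem).2 hG).const_mul _
  have hS : ∀ᶠ u in nhds (0 : ℂ),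
      HasSum (fun d => (T d - G c * (q : ℂ) ^ d) * u ^ d) (-c * dslope G c u) := by
    have : ∀ᶠ u in nhds (0 : ℂ), q * ‖u‖ < 1 :=
      (isOpen_lt (f := fun u : ℂ => q * ‖u‖) (by fun_prop) continuous_const).mem_nhds (by simp)
    filter_upwards [this] with u hu
    have hqu : ‖(q : ℂ) * u‖ < 1 := by
      rwa [norm_mul, Complex.norm_real, Real.norm_of_nonneg hq0.le]
    have hne : 1 - (q : ℂ) * u ≠ 0 := fun h => by
      rw [← sub_eq_zero.1 h, norm_one] at hqu
      exact lt_irrefl _ hqu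
    have h1 := (hT u hu).sub ((hasSum_geometric_of_norm_lt_one hqu).mul_left (G c))
    have h2 := sub_smul_dslope G c u
    rw [smul_eq_mul, ← hD u hu] at h2
    have h3 : D u - G c * (1 - (q : ℂ) * u)⁻¹ = -c * dslope G c u := by
      have h4 : u - c = -c * (1 - q * u) := by rw [hc]; field_simp; ring
      rw [h4] at h2
      field_simp
      linear_combination -h2
    rw [h3] at h1
    refine h1.congr_fun fun d => ?_
    rw [mul_pow]; ring
  set δ := min ε (1 / 4) with hδ
  have hδ0 : 0 < δ := lt_min hε (by norm_num)
  -- A circle strictly inside `|u| < q^{-1/2}`; its Cauchy bound is `q^{(1/2+δ)d}`.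
  have hr : 0 < q ^ (-(1 / 2 + δ)) := Real.rpow_pos_of_pos hq0 _
  obtain ⟨A, hA⟩ := coeff_bound hr (hE.mono fun u hu => by
    rw [mem_closedBall_zero_iff] at hu
    have h1 : ‖u‖ ^ 2 ≤ (q ^ (-(1 / 2 + δ))) ^ 2 := by gcongr
    have h2 : q * (q ^ (-(1 / 2 + δ))) ^ 2 = q ^ (-2 * δ) := by
      rw [← Real.rpow_natCast, ← Real.rpow_mul hq0.le]
      nth_rw 1 [← Real.rpow_one q]
      rw [← Real.rpow_add hq0]
      congr 1; push_cast; ring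
    have h3 : q ^ (-2 * δ) < 1 := Real.rpow_lt_one_of_one_lt_of_neg hq (by linarith)
    calc q * ‖u‖ ^ 2 ≤ q * (q ^ (-(1 / 2 + δ))) ^ 2 := by gcongr
      _ < 1 := by rwa [h2]) hS
  have hA0 : 0 ≤ A := by simpa using (norm_nonneg _).trans (hA 0)
  refine ⟨A, fun d => (hA d).trans ?_⟩
  rw [← Real.rpow_neg hq0.le, neg_neg, ← Real.rpow_natCast, ← Real.rpow_mul hq0.le]
  gcongr
  · exact hq.le
  · exact min_le_left _ _

variable {K : Type*} [Field K] [Fintype K]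

/-- The quotient of the local factor of `∏_Q (1 + (1 + ψ₁(Q) + ψ₂(Q)) u^{deg Q})` by that of
`Z(u) L(u, ψ₁) L(u, ψ₂)`. -/
noncomputable def localFactor (ψ₁ ψ₂ : K[X] → ℂ) (u : ℂ) (Q : MonicPrime K) : ℂ :=
  (1 + (1 + ψ₁ Q.1 + ψ₂ Q.1) * u ^ Q.1.natDegree) * (1 - u ^ Q.1.natDegree) *
    (1 - ψ₁ Q.1 * u ^ Q.1.natDegree) * (1 - ψ₂ Q.1 * u ^ Q.1.natDegree)

/-- In terms of the elementary symmetric functions `e₁, e₂, e₃` of `1, a, b` the product is `(1 +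
e₁x)(1 - e₁x + e₂x² - e₃x³)`, so the linear term cancels. The constant is `25 = 12 + 10 + 3`,
bounding the coefficients of `x²`, `x³`, `x⁴`. -/
theorem norm_prod_quadruple_sub_one_le {a b x : ℂ} (ha : ‖a‖ ≤ 1) (hb : ‖b‖ ≤ 1) (hx : ‖x‖ ≤ 1) :
    ‖(1 + (1 + a + b) * x) * (1 - x) * (1 - a * x) * (1 - b * x) - 1‖ ≤ 25 * ‖x‖ ^ 2 := by
  have h1 : ‖1 + a + b‖ ≤ 3 := by
    calc ‖1 + a + b‖ ≤ ‖(1 : ℂ)‖ + ‖a‖ + ‖b‖ := norm_add₃_le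
      _ ≤ 3 := by rw [norm_one]; linarith
  have h3 : ‖a * b‖ ≤ 1 := by
    rw [norm_mul]; exact mul_le_one₀ ha (norm_nonneg _) hb
  have h2 : ‖a + b + a * b‖ ≤ 3 := by
    calc ‖a + b + a * b‖ ≤ ‖a‖ + ‖b‖ + ‖a * b‖ := norm_add₃_le
      _ ≤ 3 := by linarith
  set e₁ := 1 + a + b with he₁
  set e₂ := a + b + a * b with he₂
  set e₃ := a * b with he₃
  have h : (1 + e₁ * x) * (1 - x) * (1 - a * x) * (1 - b * x) - 1 =
      ((e₂ - e₁ ^ 2) + (e₁ * e₂ - e₃) * x - e₁ * e₃ * x ^ 2) * x ^ 2 := by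
    rw [he₁, he₂, he₃]; ring
  rw [h, norm_mul, norm_pow]
  gcongr
  have b1 : ‖e₂ - e₁ ^ 2‖ ≤ 12 := by
    calc ‖e₂ - e₁ ^ 2‖ ≤ ‖e₂‖ + ‖e₁‖ ^ 2 := by rw [← norm_pow]; exact norm_sub_le _ _
      _ ≤ 3 + 3 ^ 2 := by gcongr
      _ = 12 := by norm_num
  have b2 : ‖(e₁ * e₂ - e₃) * x‖ ≤ 10 := by
    calc ‖(e₁ * e₂ - e₃) * x‖ ≤ (‖e₁‖ * ‖e₂‖ + ‖e₃‖) * ‖x‖ := by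
          rw [norm_mul, ← norm_mul e₁]; gcongr; exact norm_sub_le _ _
      _ ≤ (3 * 3 + 1) * 1 := by gcongr
      _ = 10 := by norm_num
  have b3 : ‖e₁ * e₃ * x ^ 2‖ ≤ 3 := by
    calc ‖e₁ * e₃ * x ^ 2‖ = ‖e₁‖ * ‖e₃‖ * ‖x‖ ^ 2 := by rw [norm_mul, norm_mul, norm_pow]
      _ ≤ 3 * 1 * 1 ^ 2 := by gcongr
      _ = 3 := by norm_num
  calc _ ≤ ‖e₂ - e₁ ^ 2‖ + ‖(e₁ * e₂ - e₃) * x‖ + ‖e₁ * e₃ * x ^ 2‖ :=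
        (norm_sub_le _ _).trans (add_le_add_left (norm_add_le _ _) _)
    _ ≤ 25 := by linarith

omit [Fintype K] in
theorem norm_localFactor_sub_one_le {ψ₁ ψ₂ : K[X] → ℂ} (h₁ : ∀ F, ‖ψ₁ F‖ ≤ 1)
    (h₂ : ∀ F, ‖ψ₂ F‖ ≤ 1) {u : ℂ} {ρ : ℝ} (hu : ‖u‖ ≤ ρ) (hρ : ρ ≤ 1) (Q : MonicPrime K) :
    ‖localFactor ψ₁ ψ₂ u Q - 1‖ ≤ 25 * (ρ ^ 2) ^ Q.1.natDegree := by
  refine (norm_prod_quadruple_sub_one_le (h₁ _) (h₂ _) ?_).trans ?_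
  · rw [norm_pow]; exact pow_le_one₀ (norm_nonneg _) (hu.trans hρ)
  · rw [norm_pow, ← pow_mul, ← pow_mul, mul_comm _ 2]
    gcongr

theorem le_one_of_card_mul_sq {ρ : ℝ} (h : Fintype.card K * ρ ^ 2 < 1) : ρ ≤ 1 := by
  have h1 : (1 : ℝ) ≤ Fintype.card K := by exact_mod_cast Fintype.card_pos
  nlinarith [sq_nonneg ρ]

theorem summable_localFactor {ψ₁ ψ₂ : K[X] → ℂ} (h₁ : ∀ F, ‖ψ₁ F‖ ≤ 1) (h₂ : ∀ F, ‖ψ₂ F‖ ≤ 1)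
    {u : ℂ} (hu : Fintype.card K * ‖u‖ ^ 2 < 1) :
    Summable fun Q => ‖localFactor ψ₁ ψ₂ u Q - 1‖ :=
  Summable.of_nonneg_of_le (fun _ => norm_nonneg _)
    (fun Q => norm_localFactor_sub_one_le h₁ h₂ le_rfl (le_one_of_card_mul_sq hu) Q)
    ((summable_prime_pow_natDegree (sq_nonneg _) hu).mul_left 25)

theorem multipliable_localFactor {ψ₁ ψ₂ : K[X] → ℂ} (h₁ : ∀ F, ‖ψ₁ F‖ ≤ 1)
    (h₂ : ∀ F, ‖ψ₂ F‖ ≤ 1) {u : ℂ} (hu : Fintype.card K * ‖u‖ ^ 2 < 1) :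
    Multipliable (localFactor ψ₁ ψ₂ u) := by
  simpa using multipliable_one_add_of_summable (summable_localFactor h₁ h₂ hu)

theorem differentiableOn_tprod_localFactor {ψ₁ ψ₂ : K[X] → ℂ} (h₁ : ∀ F, ‖ψ₁ F‖ ≤ 1)
    (h₂ : ∀ F, ‖ψ₂ F‖ ≤ 1) :
    DifferentiableOn ℂ (fun u => ∏' Q, localFactor ψ₁ ψ₂ u Q)
      {u : ℂ | Fintype.card K * ‖u‖ ^ 2 < 1} := by
  intro u hu
  refine DifferentiableAt.differentiableWithinAt ?_
  -- A slightly larger radius gives a majorant of the factors uniform near `u`, hence locally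
  -- uniform convergence.
  obtain ⟨ρ, hρ, hqρ⟩ : ∃ ρ, ‖u‖ < ρ ∧ Fintype.card K * ρ ^ 2 < 1 := by
    have h1 : ∀ᶠ ρ : ℝ in nhds ‖u‖, Fintype.card K * ρ ^ 2 < 1 :=
      (isOpen_lt (f := fun ρ : ℝ => Fintype.card K * ρ ^ 2) (by fun_prop)
        continuous_const).mem_nhds hu
    obtain ⟨ρ, h, h'⟩ := ((h1.filter_mono nhdsWithin_le_nhds).and
      (self_mem_nhdsWithin (s := Set.Ioi ‖u‖))).exists
    exact ⟨ρ, h', h⟩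
  have hd : ∀ Q : MonicPrime K, Differentiable ℂ fun u => localFactor ψ₁ ψ₂ u Q := fun Q => by
    unfold localFactor; fun_prop
  have hp := Summable.hasProdLocallyUniformlyOn_one_add
    (f := fun (Q : MonicPrime K) u => localFactor ψ₁ ψ₂ u Q - 1)
    (Metric.isOpen_ball (x := (0 : ℂ)) (ε := ρ))
    ((summable_prime_pow_natDegree (sq_nonneg _) hqρ).mul_left 25)
    (Filter.Eventually.of_forall fun Q v hv => norm_localFactor_sub_one_le h₁ h₂
      (mem_ball_zero_iff.1 hv).le (le_one_of_card_mul_sq hqρ) Q)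
    (fun Q => ((hd Q).sub_const 1).continuous.continuousOn)
  simp only [add_sub_cancel] at hp
  have h3 : DifferentiableOn ℂ (fun u => ∏' Q, localFactor ψ₁ ψ₂ u Q) (Metric.ball 0 ρ) := by
    refine TendstoLocallyUniformlyOn.differentiableOn hp
      (Filter.Eventually.of_forall fun S => ?_) Metric.isOpen_ball
    exact DifferentiableOn.fun_finsetProd fun Q _ => (hd Q).differentiableOn
  exact h3.differentiableAt (Metric.isOpen_ball.mem_nhds (mem_ball_zero_iff.2 hρ))

/-- The series is a finite sum, so it may be evaluated at `1/q`, on the boundary of the disc where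
the Euler product is used. -/
theorem differentiable_genSeries {ψ : K[X] → ℂ} {m : ℕ}
    (h : ∀ d, m ≤ d → ∑ F ∈ monics K d, ψ F = 0) : Differentiable ℂ (genSeries ψ) := by
  have : genSeries ψ = fun u => ∑ d ∈ Finset.range m, (∑ F ∈ monics K d, ψ F) * u ^ d := by
    funext u
    refine tsum_eq_sum fun d hd => ?_
    rw [h d (by simpa using hd), zero_mul]
  rw [this]
  fun_prop

theorem genSeries_one {u : ℂ} (hu : Fintype.card K * ‖u‖ < 1) :
    genSeries (fun _ : K[X] => 1) u = (1 - Fintype.card K * u)⁻¹ := by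
  have hqu : ‖(Fintype.card K : ℂ) * u‖ < 1 := by simpa using hu
  rw [← tsum_geometric_of_norm_lt_one hqu, genSeries]
  refine tsum_congr fun d => ?_
  rw [Finset.sum_const, card_monics, nsmul_one, mul_pow, Nat.cast_pow]

/-- The correction product is the square-free product times the three products `∏ (1 - ψ(Q) u^{deg
Q})` for `ψ = 1, ψ₁, ψ₂`; by `tsum_mul_tprod` these are the inverses of `Z`, `L(u,ψ₁)`, `L(u,ψ₂)`.
-/
theorem tprod_mul_one_sub (ψ₁ ψ₂ : K[X] →* ℂ) (h₁ : ∀ F, ‖ψ₁ F‖ ≤ 1) (h₂ : ∀ F, ‖ψ₂ F‖ ≤ 1)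
    {u : ℂ} (hu : Fintype.card K * ‖u‖ < 1) :
    (∏' Q : MonicPrime K, (1 + (1 + ψ₁ Q.1 + ψ₂ Q.1) * u ^ Q.1.natDegree)) *
      (1 - Fintype.card K * u) =
      genSeries ψ₁ u * genSeries ψ₂ u * ∏' Q, localFactor ψ₁ ψ₂ u Q := by
  have hm : ∀ ψ : K[X] →* ℂ, (∀ F, ‖ψ F‖ ≤ 1) →
      Multipliable fun Q : MonicPrime K => (1 - ψ Q.1 * u ^ Q.1.natDegree) := fun ψ hψ => by
    simp only [sub_eq_add_neg]
    exact multipliable_one_add_of_summable (by simpa only [norm_neg] using summable_norm_prime hψ hu)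
  have hone : ∀ F : K[X], ‖(1 : K[X] →* ℂ) F‖ ≤ 1 := by simp
  have m0 := hm 1 hone
  have m1 := hm ψ₁ h₁
  have m2 := hm ψ₂ h₂
  have m3 : Multipliable fun Q : MonicPrime K =>
      (1 + (1 + ψ₁ Q.1 + ψ₂ Q.1) * u ^ Q.1.natDegree) := by
    refine multipliable_one_add_of_summable (summable_norm_prime
      (ψ := fun F => 1 + ψ₁ F + ψ₂ F) (c := 3) (fun F => ?_) hu)
    calc ‖1 + ψ₁ F + ψ₂ F‖ ≤ ‖(1 : ℂ)‖ + ‖ψ₁ F‖ + ‖ψ₂ F‖ := norm_add₃_le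
      _ ≤ 3 := by rw [norm_one]; linarith [h₁ F, h₂ F]
  have e0 := tsum_mul_tprod (1 : K[X] →* ℂ) hone hu
  have e1 := tsum_mul_tprod ψ₁ h₁ hu
  have e2 := tsum_mul_tprod ψ₂ h₂ hu
  rw [← genSeries_eq_tsum hone hu] at e0
  rw [← genSeries_eq_tsum h₁ hu] at e1
  rw [← genSeries_eq_tsum h₂ hu] at e2
  have hZ : genSeries (⇑(1 : K[X] →* ℂ)) u = (1 - Fintype.card K * u)⁻¹ := genSeries_one hu
  have hH : ∏' Q, localFactor ψ₁ ψ₂ u Q = _ :=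
    (tprod_congr fun Q => by simp [localFactor]).trans
      (((m3.mul m0).mul m1).tprod_mul m2)
  rw [((m3.mul m0)).tprod_mul m1, m3.tprod_mul m0] at hH
  rw [hH]
  rw [hZ] at e0
  have hne : (1 - Fintype.card K * u) ≠ 0 := fun h => by simp [h] at e0
  have e0' := (inv_mul_eq_one₀ hne).1 e0
  rw [← e0']
  linear_combination (-(∏' Q : MonicPrime K, (1 + (1 + ψ₁ Q.1 + ψ₂ Q.1) * u ^ Q.1.natDegree)) *
      (1 - Fintype.card K * u)) * (e1 * genSeries ψ₂ u *
        (∏' Q : MonicPrime K, (1 - ψ₂ Q.1 * u ^ Q.1.natDegree)) + e2)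

theorem sum_sqfTriples_asymptotic (ψ₁ ψ₂ : K[X] →* ℂ) (h₁ : ∀ F, ‖ψ₁ F‖ ≤ 1)
    (h₂ : ∀ F, ‖ψ₂ F‖ ≤ 1) {m : ℕ} (hm₁ : ∀ d, m ≤ d → ∑ F ∈ monics K d, ψ₁ F = 0)
    (hm₂ : ∀ d, m ≤ d → ∑ F ∈ monics K d, ψ₂ F = 0) {ε : ℝ} (hε : 0 < ε) :
    ∃ A : ℝ, ∀ d : ℕ, ‖∑ t ∈ sqfTriples K d, ψ₁ t.1 * ψ₂ t.2.1 -
      genSeries ψ₁ (Fintype.card K : ℂ)⁻¹ * genSeries ψ₂ (Fintype.card K : ℂ)⁻¹ *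
        (∏' Q, localFactor ψ₁ ψ₂ (Fintype.card K : ℂ)⁻¹ Q) * (Fintype.card K : ℂ) ^ d‖ ≤
      A * (Fintype.card K : ℝ) ^ ((1 / 2 + ε) * (d : ℝ)) := by
  have hq : (1 : ℝ) < Fintype.card K := by exact_mod_cast Fintype.one_lt_card
  have := coeff_asymptotic hq (T := fun d => ∑ t ∈ sqfTriples K d, ψ₁ t.1 * ψ₂ t.2.1)
    (((differentiable_genSeries hm₁).mul (differentiable_genSeries hm₂)).differentiableOn.mul
      (differentiableOn_tprod_localFactor h₁ h₂)) (fun u hu => by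
        simp_rw [sum_sqfTriples]
        refine hasSum_sqfMonics _ (c := 3) (fun Q => ?_) hu
        calc ‖1 + ψ₁ Q.1 + ψ₂ Q.1‖ ≤ ‖(1 : ℂ)‖ + ‖ψ₁ Q.1‖ + ‖ψ₂ Q.1‖ := norm_add₃_le
          _ ≤ 3 := by rw [norm_one]; linarith [h₁ Q.1, h₂ Q.1]) (fun u hu => by
        exact_mod_cast tprod_mul_one_sub ψ₁ ψ₂ h₁ h₂ hu) hε
  simpa using this

end Biquad

/-! ### The quadratic character and the sums with prescribed parities. -/

namespace Biquad

variable {K : Type*} [Field K] [Fintype K]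

theorem finite_adjoinRoot {P : K[X]} (hP : Irreducible P) : Finite (AdjoinRoot P) := by
  have : Module.Finite K (AdjoinRoot P) := (AdjoinRoot.powerBasis hP.ne_zero).finite
  exact Module.finite_of_finite K

omit [Fintype K] in
theorem chi_norm_le (P F : K[X]) : ‖chi P F‖ ≤ 1 := by
  unfold chi quadraticCharFun
  split_ifs <;> simp

omit [Fintype K] in
theorem chiMinus_norm_le (P F : K[X]) : ‖chiMinus P F‖ ≤ 1 := by
  simpa [chiMinus] using chi_norm_le P F

theorem chi_mul {P : K[X]} (hP : Irreducible P) (F G : K[X]) :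
    chi P (F * G) = chi P F * chi P G := by
  classical
  have := Fact.mk hP
  have := finite_adjoinRoot hP
  have := Fintype.ofFinite (AdjoinRoot P)
  have h := quadraticCharFun_mul (AdjoinRoot.mk P F) (AdjoinRoot.mk P G)
  rw [← map_mul] at h
  unfold chi
  rw [← Int.cast_mul]
  congr 1
  convert h

omit [Fintype K] in
theorem chi_one {P : K[X]} (hP : Irreducible P) : chi P 1 = 1 := by
  have := Fact.mk hP
  simp [chi, quadraticCharFun]

omit [Fintype K] in
theorem chi_zero (P : K[X]) : chi P 0 = 0 := by
  simp [chi, quadraticCharFun]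

/-- The quadratic character modulo `P` as a monoid homomorphism. -/
noncomputable def chiHom {P : K[X]} (hP : Irreducible P) : K[X] →* ℂ where
  toFun := chi P
  map_one' := chi_one hP
  map_mul' := chi_mul hP

/-- The twist of the quadratic character modulo `P` as a monoid homomorphism. -/
noncomputable def chiMinusHom {P : K[X]} (hP : Irreducible P) : K[X] →* ℂ where
  toFun := chiMinus P
  map_one' := by simp [chiMinus, chi_one hP]
  map_mul' F G := by
    rcases eq_or_ne F 0 with rfl | hF
    · simp [chiMinus, chi_zero]
    rcases eq_or_ne G 0 with rfl | hG
    · simp [chiMinus, chi_zero]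
    simp only [chiMinus, natDegree_mul hF hG, chi_mul hP, pow_add]
    ring

/-- Adding a fixed residue of degree below `deg P ≤ d` permutes the monic polynomials of degree `d`.
Averaging over all residues reduces to the full sum of the quadratic character, which is zero
because odd `q` makes it nontrivial. -/
theorem sum_chi_eq_zero (hq : Odd (Fintype.card K)) {P : K[X]} (hP : Irreducible P) {d : ℕ}
    (hd : P.natDegree ≤ d) : ∑ F ∈ monics K d, chi P F = 0 := by
  classical
  have := Fact.mk hP
  have := finite_adjoinRoot hP
  have := Fintype.ofFinite (AdjoinRoot P)
  have hchar : ringChar (AdjoinRoot P) ≠ 2 := by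
    rw [← Algebra.ringChar_eq K (AdjoinRoot P)]
    intro h
    have := FiniteField.even_card_of_char_two h
    rw [Nat.odd_iff] at hq
    omega
  have hzero : ∀ b : AdjoinRoot P,
      ∑ a : AdjoinRoot P, ((quadraticCharFun (AdjoinRoot P) (b + a) : ℤ) : ℂ) = 0 := fun b => by
    refine (Fintype.sum_equiv (Equiv.addLeft b) _
      (fun a => ((quadraticCharFun (AdjoinRoot P) a : ℤ) : ℂ)) fun a => rfl).trans ?_
    rw [← Int.cast_sum]
    exact_mod_cast quadraticChar_sum_zero hchar
  have hshift : ∀ a : AdjoinRoot P, ∑ F ∈ monics K d, chi P F =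
      ∑ F ∈ monics K d, ((quadraticCharFun (AdjoinRoot P) (AdjoinRoot.mk P F + a) : ℤ) : ℂ) := by
    intro a
    obtain ⟨r, rfl⟩ := AdjoinRoot.mk_surjective a
    have hr : AdjoinRoot.mk P (r % P) = AdjoinRoot.mk P r := by
      rw [AdjoinRoot.mk_eq_mk, EuclideanDomain.mod_eq_sub_mul_div]
      exact ⟨-(r / P), by ring⟩
    have hdeg : ∀ F ∈ monics K d, (r % P).degree < F.degree := fun F hF => by
      rw [mem_monics] at hF
      rw [degree_eq_natDegree hF.1.ne_zero, hF.2]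
      refine (degree_mod_lt r hP.ne_zero).trans_le ?_
      rw [degree_eq_natDegree hP.ne_zero]
      exact_mod_cast hd
    refine (Finset.sum_bij' (fun F _ => F + r % P) (fun F _ => F - r % P) ?_ ?_ ?_ ?_ ?_).symm
    · intro F hF
      have h := hdeg F hF
      rw [mem_monics] at hF ⊢
      exact ⟨hF.1.add_of_left h, by rw [natDegree_add_eq_left_of_degree_lt h, hF.2]⟩
    · intro F hF
      have h := hdeg F hF
      rw [mem_monics] at hF ⊢
      exact ⟨hF.1.sub_of_left h, by rw [sub_eq_add_neg,
        natDegree_add_eq_left_of_degree_lt (by rwa [degree_neg]), hF.2]⟩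
    · simp
    · simp
    · intro F hF
      rw [chi, map_add, hr]
      congr!
  have h1 : ∑ _a : AdjoinRoot P, ∑ F ∈ monics K d, chi P F = 0 := by
    rw [Finset.sum_congr rfl fun a _ => hshift a, Finset.sum_comm]
    exact Finset.sum_eq_zero fun F _ => hzero _
  rw [Finset.sum_const, nsmul_eq_mul, mul_eq_zero] at h1
  refine h1.resolve_left ?_
  simp

theorem sum_chiMinus_eq_zero (hq : Odd (Fintype.card K)) {P : K[X]} (hP : Irreducible P) {d : ℕ}
    (hd : P.natDegree ≤ d) : ∑ F ∈ monics K d, chiMinus P F = 0 := by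
  have : ∀ F ∈ monics K d, chiMinus P F = (-1) ^ d * chi P F := fun F hF => by
    rw [chiMinus, ((mem_monics K).1 hF).2]
  rw [Finset.sum_congr rfl this, ← Finset.mul_sum, sum_chi_eq_zero hq hP hd, mul_zero]

omit [Fintype K] in
theorem HpmFactor_eq (χ : K[X] → ℂ) (u : ℂ) : HpmFactor χ u = localFactor χ χ u := by
  funext Q
  simp only [HpmFactor, localFactor]
  ring

omit [Fintype K] in
-- For even `deg Q` the two factors coincide literally. For odd `deg Q`, `χ_P^-(Q) = -χ_P^+(Q)` and
-- both begin with `(1 + x)(1 - x)`, `x = u^{deg Q}`, in opposite orders. Thus the mixed sums also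
-- fit the pattern with a pole at `1/q`.
theorem HzeroFactor_eq (P : K[X]) (u : ℂ) :
    HzeroFactor P u = localFactor (chi P) (chiMinus P) u := by
  funext Q
  simp only [HzeroFactor, localFactor, chiMinus, neg_pow u]
  rcases neg_one_pow_eq_or ℂ Q.1.natDegree with h | h <;> rw [h] <;> ring

omit [Fintype K] in
theorem localFactor_comm (ψ₁ ψ₂ : K[X] → ℂ) (u : ℂ) :
    localFactor ψ₁ ψ₂ u = localFactor ψ₂ ψ₁ u := by
  funext Q
  simp only [localFactor]
  ring

theorem ite_modEq_two (n : ℕ) {k : ℕ} (hk : k < 2) :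
    (if n ≡ k [MOD 2] then (1 : ℂ) else 0) = (1 + (-1) ^ k * (-1) ^ n) / 2 := by
  unfold Nat.ModEq
  rcases Nat.even_or_odd n with h | h <;> interval_cases k <;>
    simp [h.neg_one_pow, Nat.even_iff.1, Nat.odd_iff.1, h]

theorem N_eq_sum (P : K[X]) (k₁ k₂ d : ℕ) : N P k₁ k₂ d =
    ∑ t ∈ sqfTriples K d, (if t.1.natDegree + t.2.2.natDegree ≡ k₁ [MOD 2] ∧
      t.2.1.natDegree + t.2.2.natDegree ≡ k₂ [MOD 2] then 1 else 0) * chi P (t.1 * t.2.1) := by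
  classical
  simp only [N, muSq, ite_mul, one_mul, zero_mul]
  rw [← Finset.sum_filter, ← Finset.sum_filter]
  refine Finset.sum_congr ?_ fun _ _ => rfl
  ext ⟨f, g, h⟩
  simp only [Finset.mem_filter, Set.Finite.mem_toFinset, mem_sqfTriples, parityTriples,
    Set.mem_ofPred_eq]
  constructor
  · rintro ⟨⟨hf, hg, hh, hd, h1, h2⟩, hs⟩
    rw [(hf.mul hg).natDegree_mul hh, hf.natDegree_mul hg] at hd
    rw [hf.natDegree_mul hh] at h1
    rw [hg.natDegree_mul hh] at h2
    exact ⟨⟨hf, hg, hh, hd, hs⟩, h1, h2⟩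
  · rintro ⟨⟨hf, hg, hh, hd, hs⟩, h1, h2⟩
    rw [(hf.mul hg).natDegree_mul hh, hf.natDegree_mul hg, hf.natDegree_mul hh,
      hg.natDegree_mul hh]
    exact ⟨⟨hf, hg, hh, hd, h1, h2⟩, hs⟩

/-- The product of the two parity signs is `(-1)^{deg f₁ + deg f₂}`, which twists both characters. A
single sign, such as `(-1)^{deg f₁ + deg f₃}`, equals `(-1)^d (-1)^{deg f₂}`, which twists only one;
this explains the exponents `k₁ + d` and `k₂ + d`. -/
theorem N_eq {P : K[X]} (hP : Irreducible P) {k₁ k₂ : ℕ} (hk₁ : k₁ < 2) (hk₂ : k₂ < 2) (d : ℕ) :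
    N P k₁ k₂ d = (∑ t ∈ sqfTriples K d, chi P t.1 * chi P t.2.1 +
      (-1) ^ (k₁ + k₂) * ∑ t ∈ sqfTriples K d, chiMinus P t.1 * chiMinus P t.2.1 +
      (-1) ^ (k₁ + d) * ∑ t ∈ sqfTriples K d, chi P t.1 * chiMinus P t.2.1 +
      (-1) ^ (k₂ + d) * ∑ t ∈ sqfTriples K d, chiMinus P t.1 * chi P t.2.1) / 4 := by
  rw [N_eq_sum, Finset.mul_sum, Finset.mul_sum, Finset.mul_sum, ← Finset.sum_add_distrib,
    ← Finset.sum_add_distrib, ← Finset.sum_add_distrib, Finset.sum_div]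
  refine Finset.sum_congr rfl fun t ht => ?_
  obtain ⟨-, -, -, hd, -⟩ := mem_sqfTriples.1 ht
  have hand : ∀ (p r : Prop) [Decidable p] [Decidable r],
      (if p ∧ r then (1 : ℂ) else 0) = (if p then 1 else 0) * (if r then 1 else 0) := by
    intro p r _ _
    by_cases p <;> by_cases r <;> simp_all
  rw [hand, ite_modEq_two _ hk₁, ite_modEq_two _ hk₂, ← hd, chi_mul hP]
  simp only [chiMinus, pow_add]
  rcases neg_one_pow_eq_or ℂ t.1.natDegree with h1 | h1 <;>
  rcases neg_one_pow_eq_or ℂ t.2.1.natDegree with h2 | h2 <;>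
  rcases neg_one_pow_eq_or ℂ t.2.2.natDegree with h3 | h3 <;>
  rw [h1, h2, h3] <;> ring

theorem norm_N_sub_le (hq : Odd (Fintype.card K)) {P : K[X]} (hP : Irreducible P) {k₁ k₂ : ℕ}
    (hk₁ : k₁ < 2) (hk₂ : k₂ < 2) {ε : ℝ} (hε : 0 < ε) : ∃ A : ℝ, ∀ d : ℕ,
      ‖N P k₁ k₂ d - Ck P k₁ k₂ d / 4 * (Fintype.card K : ℂ) ^ d‖ ≤
        A * (Fintype.card K : ℝ) ^ ((1 / 2 + ε) * (d : ℝ)) := by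
  have h0 := fun d (hd : P.natDegree ≤ d) => sum_chi_eq_zero hq hP hd
  have h1 := fun d (hd : P.natDegree ≤ d) => sum_chiMinus_eq_zero hq hP hd
  obtain ⟨A₁, hA₁⟩ := sum_sqfTriples_asymptotic (chiHom hP) (chiHom hP) (chi_norm_le P)
    (chi_norm_le P) h0 h0 hε
  obtain ⟨A₂, hA₂⟩ := sum_sqfTriples_asymptotic (chiMinusHom hP) (chiMinusHom hP)
    (chiMinus_norm_le P) (chiMinus_norm_le P) h1 h1 hε
  obtain ⟨A₃, hA₃⟩ := sum_sqfTriples_asymptotic (chiHom hP) (chiMinusHom hP) (chi_norm_le P)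
    (chiMinus_norm_le P) h0 h1 hε
  obtain ⟨A₄, hA₄⟩ := sum_sqfTriples_asymptotic (chiMinusHom hP) (chiHom hP) (chiMinus_norm_le P)
    (chi_norm_le P) h1 h0 hε
  refine ⟨(A₁ + A₂ + A₃ + A₄) / 4, fun d => ?_⟩
  have e0 : ⇑(chiHom hP) = chi P := rfl
  have e1 : ⇑(chiMinusHom hP) = chiMinus P := rfl
  simp only [e0, e1, localFactor_comm (chiMinus P) (chi P)] at hA₁ hA₂ hA₃ hA₄
  simp only [← HpmFactor_eq, ← HzeroFactor_eq] at hA₁ hA₂ hA₃ hA₄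
  specialize hA₁ d
  specialize hA₂ d
  specialize hA₃ d
  specialize hA₄ d
  rw [N_eq hP hk₁ hk₂]
  simp only [Ck, Hpm, Hzero, LFun]
  set q : ℂ := (Fintype.card K : ℂ)
  set X₁ := ∑ t ∈ sqfTriples K d, chi P t.1 * chi P t.2.1
  set X₂ := ∑ t ∈ sqfTriples K d, chiMinus P t.1 * chiMinus P t.2.1
  set X₃ := ∑ t ∈ sqfTriples K d, chi P t.1 * chiMinus P t.2.1
  set X₄ := ∑ t ∈ sqfTriples K d, chiMinus P t.1 * chi P t.2.1
  set a := genSeries (chi P) q⁻¹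
  set b := genSeries (chiMinus P) q⁻¹
  set E₁ := X₁ - a * a * (∏' Q, HpmFactor (chi P) q⁻¹ Q) * q ^ d
  set E₂ := X₂ - b * b * (∏' Q, HpmFactor (chiMinus P) q⁻¹ Q) * q ^ d
  set E₃ := X₃ - a * b * (∏' Q, HzeroFactor P q⁻¹ Q) * q ^ d
  set E₄ := X₄ - b * a * (∏' Q, HzeroFactor P q⁻¹ Q) * q ^ d
  -- The total error is exactly this signed combination of the four errors, so their constants add
  -- up to a quarter of the sum.
  have key : ∀ x : ℂ, x = (E₁ + (-1) ^ (k₁ + k₂) * E₂ + (-1) ^ (k₁ + d) * E₃ +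
      (-1) ^ (k₂ + d) * E₄) / 4 →
      ‖x‖ ≤ (A₁ + A₂ + A₃ + A₄) / 4 * (Fintype.card K : ℝ) ^ ((1 / 2 + ε) * (d : ℝ)) := by
    rintro x rfl
    have h2 : ‖E₁ + (-1) ^ (k₁ + k₂) * E₂ + (-1) ^ (k₁ + d) * E₃ + (-1) ^ (k₂ + d) * E₄‖ ≤
        ‖E₁‖ + ‖E₂‖ + ‖E₃‖ + ‖E₄‖ := by
      refine (norm_add_le _ _).trans (add_le_add ((norm_add_le _ _).trans
        (add_le_add ((norm_add_le _ _).trans (add_le_add le_rfl ?_)) ?_)) ?_) <;> simp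
    rw [norm_div, Complex.norm_ofNat]
    linarith
  refine key _ ?_
  simp only [E₁, E₂, E₃, E₄, pow_add]
  ring

end Biquad

/-! ### Counting square-free polynomials and the sum over `F_g`. -/

namespace Biquad

variable {K : Type*} [Field K] [Fintype K]

/-- Factorwise `(1 + x)(1 - x) = 1 - x²`, so the square-free product is `Z(u)/Z(u²)`. -/
theorem tprod_one_add_mul {u : ℂ} (hu : Fintype.card K * ‖u‖ < 1) :
    (∏' Q : MonicPrime K, (1 + 1 * u ^ Q.1.natDegree)) * (1 - Fintype.card K * u) =
      1 - Fintype.card K * u ^ 2 := by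
  have hq : (1 : ℝ) ≤ Fintype.card K := by exact_mod_cast Fintype.card_pos
  have hu2 : Fintype.card K * ‖u ^ 2‖ < 1 := by
    have h1 : ‖u‖ ≤ 1 := by nlinarith [norm_nonneg u]
    rw [norm_pow]
    calc Fintype.card K * ‖u‖ ^ 2 = Fintype.card K * ‖u‖ * ‖u‖ := by ring
      _ ≤ Fintype.card K * ‖u‖ * 1 := by gcongr
      _ < 1 := by rwa [mul_one]
  have hone : ∀ F : K[X], ‖(1 : K[X] →* ℂ) F‖ ≤ 1 := by simp
  have hP : ∀ v : ℂ, Fintype.card K * ‖v‖ < 1 →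
      ∏' Q : MonicPrime K, (1 - v ^ Q.1.natDegree) = 1 - Fintype.card K * v := fun v hv => by
    have e0 := tsum_mul_tprod (1 : K[X] →* ℂ) hone hv
    rw [← genSeries_eq_tsum hone hv] at e0
    have hZ : genSeries (⇑(1 : K[X] →* ℂ)) v = (1 - Fintype.card K * v)⁻¹ := genSeries_one hv
    rw [hZ] at e0
    have hne : (1 - Fintype.card K * v) ≠ 0 := fun h => by simp [h] at e0
    simpa using ((inv_mul_eq_one₀ hne).1 e0).symm
  have hs := summable_norm_prime (K := K) (ψ := fun _ => 1) (c := 1) (by simp) hu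
  have m1 : Multipliable fun Q : MonicPrime K => (1 + 1 * u ^ Q.1.natDegree) :=
    multipliable_one_add_of_summable hs
  have m2 : Multipliable fun Q : MonicPrime K => (1 - u ^ Q.1.natDegree) := by
    simp only [sub_eq_add_neg]
    exact multipliable_one_add_of_summable (by simpa using hs)
  rw [← hP u hu, ← hP _ hu2, ← m1.tprod_mul m2]
  refine tprod_congr fun Q => ?_
  rw [← pow_mul, mul_comm 2, pow_mul]
  ring

/-- Compare coefficients in `(1 - qu²)/(1 - qu)`. The bound on `n` matters: in degrees `0` and `1`
every monic polynomial is square-free. -/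
theorem card_sqfMonics {n : ℕ} (hn : 2 ≤ n) :
    ((sqfMonics K n).card : ℂ) = (Fintype.card K : ℂ) ^ n - (Fintype.card K : ℂ) ^ (n - 1) := by
  have hnhds : ∀ᶠ u in nhds (0 : ℂ), Fintype.card K * ‖u‖ < 1 :=
    (isOpen_lt (f := fun u : ℂ => Fintype.card K * ‖u‖) (by fun_prop)
      continuous_const).mem_nhds (by simp)
  have h := coeff_unique
    (f := fun u => ∏' Q : MonicPrime K, (1 + 1 * u ^ Q.1.natDegree))
    (S := fun d => ((sqfMonics K d).card : ℂ))
    (T := fun d => (Fintype.card K : ℂ) ^ d - if 2 ≤ d then (Fintype.card K : ℂ) ^ (d - 1) else 0)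
    (by
      filter_upwards [hnhds] with u hu
      simpa using hasSum_sqfMonics (K := K) (fun _ => 1) (c := 1) (by simp) hu)
    (by
      filter_upwards [hnhds] with u hu
      have hqu : ‖(Fintype.card K : ℂ) * u‖ < 1 := by simpa using hu
      have hne : 1 - (Fintype.card K : ℂ) * u ≠ 0 := fun h => by
        rw [← sub_eq_zero.1 h, norm_one] at hqu
        exact lt_irrefl _ hqu
      have hg := hasSum_geometric_of_norm_lt_one hqu
      have h2 : HasSum (fun d => (if 2 ≤ d then (Fintype.card K : ℂ) ^ (d - 1) else 0) * u ^ d)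
          (Fintype.card K * u ^ 2 * (1 - Fintype.card K * u)⁻¹) := by
        rw [← hasSum_nat_add_iff' 2]
        simp only [Finset.sum_range_succ, Finset.sum_range_zero]
        simp only [Nat.not_ofNat_le_one, if_false, zero_mul, add_zero, sub_zero,
          nonpos_iff_eq_zero, OfNat.ofNat_ne_zero]
        refine (hg.mul_left (Fintype.card K * u ^ 2)).congr_fun fun d => ?_
        rw [if_pos (by omega), show d + 2 - 1 = d + 1 by omega, mul_pow]
        ring
      have h3 : ∏' Q : MonicPrime K, (1 + 1 * u ^ Q.1.natDegree) =
          (1 - Fintype.card K * u)⁻¹ - Fintype.card K * u ^ 2 * (1 - Fintype.card K * u)⁻¹ := by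
        rw [← one_sub_mul, eq_mul_inv_iff_mul_eq₀ hne]
        exact tprod_one_add_mul hu
      rw [h3]
      refine (hg.sub h2).congr_fun fun d => ?_
      rw [mul_pow, sub_mul])
  simpa [hn] using congrFun h n

theorem inv_zetaQ_two : (zetaQ K 2)⁻¹ = 1 - (Fintype.card K : ℂ)⁻¹ := by
  have hq : (1 : ℝ) < Fintype.card K := by exact_mod_cast Fintype.one_lt_card
  have hqc : (Fintype.card K : ℂ) ≠ 0 := by
    exact_mod_cast Fintype.card_ne_zero
  have h : (Fintype.card K : ℂ) ^ (-2 : ℂ) = ((Fintype.card K : ℂ) ^ 2)⁻¹ := by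
    rw [Complex.cpow_neg]
    congr 1
    exact_mod_cast Complex.cpow_natCast (Fintype.card K : ℂ) 2
  rw [zetaQ, Z, h, genSeries_one, inv_inv]
  · field_simp
  · rw [norm_inv, norm_pow, Complex.norm_natCast, sq, mul_inv, mul_inv_cancel_left₀ (by linarith)]
    exact inv_lt_one_of_one_lt₀ hq

theorem multiset_eq_iff {n a b c : ℕ} (hn : 0 < n) (h : a + b + c = n) :
    ({a, b, c} : Multiset ℕ) = {n, 0, 0} ↔ (b = 0 ∧ c = 0) ∨ (a = 0 ∧ c = 0) ∨ (a = 0 ∧ b = 0) := by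
  constructor
  · intro he
    have : n ∈ ({a, b, c} : Multiset ℕ) := by rw [he]; simp
    simp only [Multiset.insert_eq_cons, Multiset.mem_cons, Multiset.mem_singleton] at this
    omega
  · simp only [Multiset.insert_eq_cons, ← Multiset.cons_zero]
    rintro (⟨rfl, rfl⟩ | ⟨rfl, rfl⟩ | ⟨rfl, rfl⟩)
    · simp [← h]
    · simp [← h, Multiset.cons_swap 0 b]
    · obtain rfl : c = n := by omega
      rw [Multiset.cons_swap 0 c 0, Multiset.cons_swap 0 c]

theorem sum_sqfTriples_single (f : K[X] × K[X] × K[X] → ℂ) (n : ℕ) (e : K[X] → K[X] × K[X] × K[X])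
    (p : K[X] × K[X] × K[X] → Prop) [DecidablePred p]
    (h1 : ∀ F ∈ sqfMonics K n, e F ∈ sqfTriples K n ∧ p (e F)) (h2 : Function.Injective e)
    (h3 : ∀ t ∈ sqfTriples K n, p t → ∃ F ∈ sqfMonics K n, e F = t) :
    ∑ t ∈ sqfTriples K n, (if p t then f t else 0) = ∑ F ∈ sqfMonics K n, f (e F) := by
  rw [← Finset.sum_filter]
  refine (Finset.sum_nbij e (fun F hF => Finset.mem_filter.2 (h1 F hF)) h2.injOn ?_
    fun _ _ => rfl).symm
  intro t ht
  rw [Finset.mem_coe, Finset.mem_filter] at ht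
  obtain ⟨F, hF, rfl⟩ := h3 t ht.1 ht.2
  exact ⟨F, hF, rfl⟩

theorem sqfreeCharSum_eq (P : K[X]) (d : ℕ) :
    sqfreeCharSum P d = ∑ F ∈ sqfMonics K d, chi P F := by
  classical
  simp only [sqfreeCharSum, muSq, ite_mul, one_mul, zero_mul]
  rw [← Finset.sum_filter, sqfMonics]

open Classical in
-- The nonconstant entry `f` can sit in three places. The first two contribute `χ_P(f)` each; in the
-- third the character is evaluated at `1`, giving the plain count. The cases are disjoint because
-- `n > 0`.
theorem sum_excluded {P : K[X]} (hP : Irreducible P) {n : ℕ} (hn : 0 < n) :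
    ∑ t ∈ sqfTriples K n, (if ({t.1.natDegree, t.2.1.natDegree, t.2.2.natDegree} : Multiset ℕ) =
      {n, 0, 0} then chi P (t.1 * t.2.1) else 0) =
      2 * sqfreeCharSum P n + (sqfMonics K n).card := by
  have h : ∀ t ∈ sqfTriples K n,
      (if ({t.1.natDegree, t.2.1.natDegree, t.2.2.natDegree} : Multiset ℕ) = {n, 0, 0}
        then chi P (t.1 * t.2.1) else 0) =
      (if t.2.1.natDegree = 0 ∧ t.2.2.natDegree = 0 then chi P (t.1 * t.2.1) else 0) +
      (if t.1.natDegree = 0 ∧ t.2.2.natDegree = 0 then chi P (t.1 * t.2.1) else 0) +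
      (if t.1.natDegree = 0 ∧ t.2.1.natDegree = 0 then chi P (t.1 * t.2.1) else 0) := by
    intro t ht
    obtain ⟨-, -, -, hd, -⟩ := mem_sqfTriples.1 ht
    simp only [multiset_eq_iff hn hd]
    by_cases h1 : t.1.natDegree = 0 <;> by_cases h2 : t.2.1.natDegree = 0 <;>
      by_cases h3 : t.2.2.natDegree = 0 <;> simp [h1, h2, h3]
    omega
  rw [Finset.sum_congr rfl h, Finset.sum_add_distrib, Finset.sum_add_distrib,
    sum_sqfTriples_single _ n (fun F => (F, 1, 1)),
    sum_sqfTriples_single _ n (fun F => (1, F, 1)),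
    sum_sqfTriples_single _ n (fun F => (1, 1, F))]
  · simp only [mul_one, one_mul, chi_one hP, sqfreeCharSum_eq, Finset.sum_const, nsmul_one]
    ring
  all_goals try (intro F G hFG; simpa using hFG)
  all_goals try (
    intro F hF
    rw [mem_sqfMonics] at hF
    simp [mem_sqfTriples, hF])
  all_goals
    rintro ⟨f, g, h⟩ ht hp
    obtain ⟨hf, hg, hh, hd, hs⟩ := mem_sqfTriples.1 ht
    simp only at hf hg hh hd hs hp
    obtain ⟨h1, h2⟩ := hp
  · rw [hf.natDegree_eq_zero] at h1
    rw [hg.natDegree_eq_zero] at h2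
    subst h1 h2
    exact ⟨h, mem_sqfMonics.2 ⟨hh, by simpa using hd, by simpa using hs⟩, rfl⟩
  · rw [hf.natDegree_eq_zero] at h1
    rw [hh.natDegree_eq_zero] at h2
    subst h1 h2
    exact ⟨g, mem_sqfMonics.2 ⟨hg, by simpa using hd, by simpa using hs⟩, rfl⟩
  · rw [hg.natDegree_eq_zero] at h1
    rw [hh.natDegree_eq_zero] at h2
    subst h1 h2
    exact ⟨f, mem_sqfMonics.2 ⟨hf, by simpa using hd, by simpa using hs⟩, rfl⟩

/-- In each parity case only one of the two excluded multisets has the right sum of degrees, so the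
other exclusion is automatic. -/
theorem mem_Fg_iff {g : ℕ} {t : K[X] × K[X] × K[X]} :
    t ∈ Fg K g ↔ (t ∈ sqfTriples K (g + 3) ∧
      ((t.1.natDegree + t.2.2.natDegree ≡ 0 [MOD 2] ∧
        t.2.1.natDegree + t.2.2.natDegree ≡ 0 [MOD 2]) ∧
      ({t.1.natDegree, t.2.1.natDegree, t.2.2.natDegree} : Multiset ℕ) ≠ {g + 3, 0, 0})) ∨
      (t ∈ sqfTriples K (g + 2) ∧
      (¬ (t.1.natDegree + t.2.2.natDegree ≡ 0 [MOD 2] ∧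
        t.2.1.natDegree + t.2.2.natDegree ≡ 0 [MOD 2]) ∧
      ({t.1.natDegree, t.2.1.natDegree, t.2.2.natDegree} : Multiset ℕ) ≠ {g + 2, 0, 0})) := by
  have hsum : ∀ {a b c n : ℕ}, ({a, b, c} : Multiset ℕ) = {n, 0, 0} → a + b + c = n := by
    intro a b c n h
    simpa [add_assoc] using congrArg Multiset.sum h
  obtain ⟨a, b, c⟩ := t
  simp only [Fg, FgHat, mem_sqfTriples, Set.mem_ofPred_eq, squarefree_mul_iff,
    isRelPrime_iff_isCoprime, IsCoprime.mul_left_iff, genusL, Nat.ModEq, Nat.zero_mod]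
  by_cases hpar : (a.natDegree + c.natDegree) % 2 = 0 ∧ (b.natDegree + c.natDegree) % 2 = 0
  · rw [if_pos hpar]
    constructor
    · rintro ⟨⟨ha, hb, hc, hab, hac, hbc, -, hd, h3, h2⟩, ma, mb, mc⟩
      exact Or.inl ⟨⟨ma, mb, mc, hd, ⟨hac, hbc⟩, ⟨hab, ha, hb⟩, hc⟩, hpar, h3⟩
    · rintro (⟨⟨ma, mb, mc, hd, ⟨hac, hbc⟩, ⟨hab, ha, hb⟩, hc⟩, -, h3⟩ | ⟨-, h, -⟩)
      · exact ⟨⟨ha, hb, hc, hab, hac, hbc, mc, hd, h3, fun h => by have := hsum h; omega⟩, ma, mb, mc⟩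
      · exact absurd hpar h
  · rw [if_neg hpar]
    constructor
    · rintro ⟨⟨ha, hb, hc, hab, hac, hbc, -, hd, h3, h2⟩, ma, mb, mc⟩
      exact Or.inr ⟨⟨ma, mb, mc, by omega, ⟨hac, hbc⟩, ⟨hab, ha, hb⟩, hc⟩, hpar, h2⟩
    · rintro (⟨-, h, -⟩ | ⟨⟨ma, mb, mc, hd, ⟨hac, hbc⟩, ⟨hab, ha, hb⟩, hc⟩, -, h2⟩)
      · exact absurd h hpar
      · exact ⟨⟨ha, hb, hc, hab, hac, hbc, mc, by omega,
          fun h => by have := hsum h; omega, h2⟩, ma, mb, mc⟩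

theorem disjoint_sqfTriples {m n : ℕ} (h : m ≠ n) :
    Disjoint (sqfTriples K m) (sqfTriples K n) := by
  rw [Finset.disjoint_left]
  intro t h1 h2
  rw [mem_sqfTriples] at h1 h2
  exact h (h1.2.2.2.1.symm.trans h2.2.2.2.1)

/-- Here `n` is a condition not depending on the triple: on the excluded triples (`e`) the parity
condition is equivalent to it, so their contribution can be subtracted with a constant factor. -/
theorem ite_and_not_eq {p r e n : Prop} [Decidable p] [Decidable r] [Decidable e] [Decidable n]
    (h : e → (p ∧ r ↔ n)) (z : ℂ) : (if (p ∧ r) ∧ ¬ e then z else 0) =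
      (if p ∧ r then 1 else 0) * z - (if n then 1 else 0) * (if e then z else 0) := by
  by_cases p <;> by_cases r <;> by_cases e <;> by_cases n <;> simp_all

theorem ite_not_and_not_eq {p r e n : Prop} [Decidable p] [Decidable r] [Decidable e]
    [Decidable n] (h : e → (¬ (p ∧ r) ↔ n)) (z : ℂ) : (if ¬ (p ∧ r) ∧ ¬ e then z else 0) =
      (if p ∧ ¬ r then 1 else 0) * z + (if ¬ p ∧ r then 1 else 0) * z +
        (if ¬ p ∧ ¬ r then 1 else 0) * z - (if n then 1 else 0) * (if e then z else 0) := by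
  by_cases p <;> by_cases r <;> by_cases e <;> by_cases n <;> simp_all

theorem modEq_one_iff (n : ℕ) : n ≡ 1 [MOD 2] ↔ ¬ n ≡ 0 [MOD 2] := by
  simp only [Nat.ModEq]
  omega

theorem sumFg_eq {P : K[X]} (hP : Irreducible P) (g : ℕ) :
    sumFg P g = N P 0 0 (g + 3) + (N P 0 1 (g + 2) + N P 1 0 (g + 2) + N P 1 1 (g + 2)) -
      (1 - eta g) * (2 * (sqfreeCharSum P (g + 2) + sqfreeCharSum P (g + 3)) +
        ((sqfMonics K (g + 2)).card + (sqfMonics K (g + 3)).card)) := by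
  classical
  have hFg : (Fg_finite K g).toFinset =
      ((sqfTriples K (g + 3)).filter fun t => (t.1.natDegree + t.2.2.natDegree ≡ 0 [MOD 2] ∧
        t.2.1.natDegree + t.2.2.natDegree ≡ 0 [MOD 2]) ∧
        ({t.1.natDegree, t.2.1.natDegree, t.2.2.natDegree} : Multiset ℕ) ≠ {g + 3, 0, 0}) ∪
      ((sqfTriples K (g + 2)).filter fun t => ¬ (t.1.natDegree + t.2.2.natDegree ≡ 0 [MOD 2] ∧
        t.2.1.natDegree + t.2.2.natDegree ≡ 0 [MOD 2]) ∧
        ({t.1.natDegree, t.2.1.natDegree, t.2.2.natDegree} : Multiset ℕ) ≠ {g + 2, 0, 0}) := by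
    ext t
    rw [Set.Finite.mem_toFinset, mem_Fg_iff, Finset.mem_union, Finset.mem_filter, Finset.mem_filter]
  have hη : ∀ n, n % 2 = (g + 1) % 2 → (1 : ℂ) - eta g = if n % 2 = 0 then 1 else 0 := by
    intro n hn
    rw [eta]
    by_cases h : Even g
    · rw [if_pos h, if_neg (by rw [Nat.even_iff] at h; omega), sub_self]
    · rw [if_neg h, if_pos (by rw [Nat.even_iff] at h; omega), sub_zero]
  rw [sumFg, hFg, Finset.sum_union (Finset.disjoint_filter_filter
    (disjoint_sqfTriples (by omega))), Finset.sum_filter, Finset.sum_filter]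
  have e3 : ∑ t ∈ sqfTriples K (g + 3), (if (t.1.natDegree + t.2.2.natDegree ≡ 0 [MOD 2] ∧
        t.2.1.natDegree + t.2.2.natDegree ≡ 0 [MOD 2]) ∧
        ({t.1.natDegree, t.2.1.natDegree, t.2.2.natDegree} : Multiset ℕ) ≠ {g + 3, 0, 0}
        then chi P (t.1 * t.2.1) else 0) = N P 0 0 (g + 3) -
        (1 - eta g) * (2 * sqfreeCharSum P (g + 3) + (sqfMonics K (g + 3)).card) := by
    rw [← sum_excluded hP (by omega), N_eq_sum, Finset.mul_sum, ← Finset.sum_sub_distrib,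
      hη (g + 3) (by omega)]
    refine Finset.sum_congr rfl fun t ht => ?_
    obtain ⟨-, -, -, hd, -⟩ := mem_sqfTriples.1 ht
    refine ite_and_not_eq (fun h => ?_) _
    rw [multiset_eq_iff (Nat.succ_pos _) hd] at h
    simp only [Nat.ModEq]
    omega
  have e2 : ∑ t ∈ sqfTriples K (g + 2), (if ¬ (t.1.natDegree + t.2.2.natDegree ≡ 0 [MOD 2] ∧
        t.2.1.natDegree + t.2.2.natDegree ≡ 0 [MOD 2]) ∧
        ({t.1.natDegree, t.2.1.natDegree, t.2.2.natDegree} : Multiset ℕ) ≠ {g + 2, 0, 0}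
        then chi P (t.1 * t.2.1) else 0) =
        N P 0 1 (g + 2) + N P 1 0 (g + 2) + N P 1 1 (g + 2) -
        (1 - eta g) * (2 * sqfreeCharSum P (g + 2) + (sqfMonics K (g + 2)).card) := by
    rw [← sum_excluded hP (by omega), N_eq_sum, N_eq_sum, N_eq_sum, Finset.mul_sum,
      ← Finset.sum_add_distrib, ← Finset.sum_add_distrib, ← Finset.sum_sub_distrib,
      -- The total degree is `g + 2`, but an excluded triple fails to be even in both parities
      -- exactly when `g + 2` is odd, that is, when `g + 3` is even.
      hη (g + 3) (by omega)]
    refine Finset.sum_congr rfl fun t ht => ?_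
    obtain ⟨-, -, -, hd, -⟩ := mem_sqfTriples.1 ht
    simp only [modEq_one_iff]
    refine ite_not_and_not_eq (fun h => ?_) _
    rw [multiset_eq_iff (Nat.succ_pos _) hd] at h
    simp only [Nat.ModEq]
    omega
  rw [e3, e2]
  ring

theorem norm_sumFg_sub_le (hq : Odd (Fintype.card K)) {P : K[X]} (hP : Irreducible P) {ε : ℝ}
    (hε : 0 < ε) : ∃ A : ℝ, ∀ g : ℕ,
      ‖sumFg P g - (C P g / 4 * (Fintype.card K : ℂ) ^ (g + 3) - (1 - eta g) *
        (2 * (sqfreeCharSum P (g + 2) + sqfreeCharSum P (g + 3)) +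
          ((Fintype.card K : ℂ) + 1) / (Fintype.card K : ℂ) *
            ((Fintype.card K : ℂ) ^ (g + 3) / zetaQ K 2)))‖ ≤
        A * (Fintype.card K : ℝ) ^ ((1 / 2 + ε) * (g : ℝ)) := by
  have hq1 : (1 : ℝ) ≤ Fintype.card K := by exact_mod_cast Fintype.card_pos
  have hqc : (Fintype.card K : ℂ) ≠ 0 := by exact_mod_cast Fintype.card_ne_zero
  obtain ⟨A₁, hA₁⟩ := norm_N_sub_le hq hP (k₁ := 0) (k₂ := 0) (by norm_num) (by norm_num) hε
  obtain ⟨A₂, hA₂⟩ := norm_N_sub_le hq hP (k₁ := 0) (k₂ := 1) (by norm_num) (by norm_num) hε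
  obtain ⟨A₃, hA₃⟩ := norm_N_sub_le hq hP (k₁ := 1) (k₂ := 0) (by norm_num) (by norm_num) hε
  obtain ⟨A₄, hA₄⟩ := norm_N_sub_le hq hP (k₁ := 1) (k₂ := 1) (by norm_num) (by norm_num) hε
  have hpow : ∀ (g k : ℕ), (Fintype.card K : ℝ) ^ ((1 / 2 + ε) * ((g + k : ℕ) : ℝ)) =
      (Fintype.card K : ℝ) ^ ((1 / 2 + ε) * (k : ℝ)) *
        (Fintype.card K : ℝ) ^ ((1 / 2 + ε) * (g : ℝ)) := fun g k => by
    rw [← Real.rpow_add (by linarith)]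
    congr 1; push_cast; ring
  refine ⟨A₁ * (Fintype.card K : ℝ) ^ ((1 / 2 + ε) * ((3 : ℕ) : ℝ)) +
    (A₂ + A₃ + A₄) * (Fintype.card K : ℝ) ^ ((1 / 2 + ε) * ((2 : ℕ) : ℝ)), fun g => ?_⟩
  specialize hA₁ (g + 3)
  specialize hA₂ (g + 2)
  specialize hA₃ (g + 2)
  specialize hA₄ (g + 2)
  rw [hpow] at hA₁ hA₂ hA₃ hA₄
  -- An exact identity: `C(g;P)` is `C_{0,0}(g+3)` plus `1/q` times the three other constants at `g
  -- + 2`, and the `ζ_q(2)` term is precisely the number `q^{g+3} - q^{g+1}` of square-free monic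
  -- polynomials of degree `g+2` or `g+3`. All error comes from the four sums `N`.
  have hid : sumFg P g - (C P g / 4 * (Fintype.card K : ℂ) ^ (g + 3) - (1 - eta g) *
        (2 * (sqfreeCharSum P (g + 2) + sqfreeCharSum P (g + 3)) +
          ((Fintype.card K : ℂ) + 1) / (Fintype.card K : ℂ) *
            ((Fintype.card K : ℂ) ^ (g + 3) / zetaQ K 2))) =
      (N P 0 0 (g + 3) - Ck P 0 0 (g + 3) / 4 * (Fintype.card K : ℂ) ^ (g + 3)) +
      (N P 0 1 (g + 2) - Ck P 0 1 (g + 2) / 4 * (Fintype.card K : ℂ) ^ (g + 2)) +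
      (N P 1 0 (g + 2) - Ck P 1 0 (g + 2) / 4 * (Fintype.card K : ℂ) ^ (g + 2)) +
      (N P 1 1 (g + 2) - Ck P 1 1 (g + 2) / 4 * (Fintype.card K : ℂ) ^ (g + 2)) := by
    rw [sumFg_eq hP, card_sqfMonics (by omega), card_sqfMonics (by omega),
      div_eq_mul_inv _ (zetaQ K 2), inv_zetaQ_two, show g + 2 - 1 = g + 1 by omega,
      show g + 3 - 1 = g + 2 by omega]
    simp only [C, Ck, pow_add, pow_zero, pow_one]
    field_simp
    ring
  rw [hid]
  refine (norm_add_le _ _).trans ((add_le_add ((norm_add_le _ _).trans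
    (add_le_add (norm_add_le _ _) le_rfl)) le_rfl).trans ?_)
  linarith

end Biquad

theorem proposition6p2 {K : Type*} [Field K] [Fintype K] (hq : Odd (Fintype.card K))
    (P : K[X]) (hP : Irreducible P) :
    -- `L(u, χ_P^±)` are polynomials in `u` of degree less than `deg P`
    (∀ d : ℕ, P.natDegree ≤ d →
      ∑ F ∈ Biquad.monics K d, Biquad.chi P F = 0 ∧
      ∑ F ∈ Biquad.monics K d, Biquad.chiMinus P F = 0) ∧
    -- the products `H_{P,+}(u)`, `H_{P,-}(u)`, `H_{P,0}(u)` converge for `|u| < q^{-1/2}`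
    (∀ u : ℂ, ‖u‖ < (Fintype.card K : ℝ) ^ (-(1 / 2) : ℝ) →
      Multipliable (Biquad.HpmFactor (Biquad.chi P) u) ∧
      Multipliable (Biquad.HpmFactor (Biquad.chiMinus P) u) ∧
      Multipliable (Biquad.HzeroFactor P u)) ∧
    -- the asymptotic formula for `N_{k₁,k₂}(d;P)`
    (∀ k₁ k₂ : Fin 2, ∀ ε : ℝ, 0 < ε → ∃ A : ℝ, ∀ d : ℕ,
      ‖Biquad.N P k₁ k₂ d - Biquad.Ck P k₁ k₂ d / 4 * (Fintype.card K : ℂ) ^ d‖ ≤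
        A * (Fintype.card K : ℝ) ^ ((1 / 2 + ε) * (d : ℝ))) ∧
    -- the asymptotic formula for the sum over `F_g`
    (∀ ε : ℝ, 0 < ε → ∃ A : ℝ, ∀ g : ℕ,
      ‖Biquad.sumFg P g -
          (Biquad.C P g / 4 * (Fintype.card K : ℂ) ^ (g + 3) -
            (1 - Biquad.eta g) *
              (2 * (Biquad.sqfreeCharSum P (g + 2) + Biquad.sqfreeCharSum P (g + 3)) +
                ((Fintype.card K : ℂ) + 1) / (Fintype.card K : ℂ) *
                  ((Fintype.card K : ℂ) ^ (g + 3) / Biquad.zetaQ K 2)))‖ ≤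
        A * (Fintype.card K : ℝ) ^ ((1 / 2 + ε) * (g : ℝ))) := by
  refine ⟨fun d hd => ⟨Biquad.sum_chi_eq_zero hq hP hd, Biquad.sum_chiMinus_eq_zero hq hP hd⟩,
    fun u hu => ?_, fun k₁ k₂ ε hε => Biquad.norm_N_sub_le hq hP k₁.2 k₂.2 hε,
    fun ε hε => Biquad.norm_sumFg_sub_le hq hP hε⟩
  have hq0 : (0 : ℝ) < Fintype.card K := by exact_mod_cast Fintype.card_pos
  have hu2 : Fintype.card K * ‖u‖ ^ 2 < 1 := by
    have h1 : ‖u‖ ^ 2 < ((Fintype.card K : ℝ) ^ (-(1 / 2) : ℝ)) ^ 2 := by gcongr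
    rw [← Real.rpow_natCast (_ ^ _), ← Real.rpow_mul hq0.le,
      show (-(1 / 2) : ℝ) * (2 : ℕ) = -1 by norm_num, Real.rpow_neg_one] at h1
    calc Fintype.card K * ‖u‖ ^ 2 < Fintype.card K * (Fintype.card K : ℝ)⁻¹ := by gcongr
      _ = 1 := mul_inv_cancel₀ hq0.ne'
  have h0 := Biquad.chi_norm_le P
  have h1 := Biquad.chiMinus_norm_le P
  rw [Biquad.HpmFactor_eq, Biquad.HpmFactor_eq, Biquad.HzeroFactor_eq]
  exact ⟨Biquad.multipliable_localFactor h0 h0 hu2, Biquad.multipliable_localFactor h1 h1 hu2,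
    Biquad.multipliable_localFactor h0 h1 hu2⟩
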